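/- Let $d\ge 1$ be an integer, let $p\ge 1$ be real with $d<6p$, let $T>0$, and let $u_0\in L^{2p}(\mathbb R^d;\mathbb R)$. For $t>0$ and $x,y\in\mathbb R^d$ let $$K_{t;x,y}=(2\pi)^{-d}\int_{\mathbb R^d}e^{-\frac t8(-2+|\xi|^2)^2}\cos(\langle\xi,x-y\rangle)\,d\xi$$ be the L-KS kernel. For $\tau>0$, a function $U\in C([0,\tau];L^{2p}(\mathbb R^d;\mathbb R))$ is called an L-KS (mild) solution on $[0,\tau]$ of $$\partial_tU=-\tfrac18(\Delta+2)^2U-\tfrac12\sum_{k=1}^d\partial_kU^2,\qquad U(0,\cdot)=u_0,$$ if $U(0)=u_0$ and, for every $t\in(0,\tau]$ and almost every $x\in\mathbb R^d$, all the integrals below exist and $$U(t,x)=\int_{\mathbb R^d}K_{t;x,y}\,u_0(y)\,dy+\tfrac12\sum_{\ell=1}^d\int_0^t\int_{\mathbb R^d}\frac{\partial K_{t-s;x,y}}{\partial y_\ell}\,U^2(s,y)\,dy\,ds .$$ Then: 1. (Local existence and uniqueness.) There exist a time $\tau\in(0,T]$ and a unique L-KS solution $U\in C([0,\tau];L^{2p}(\mathbb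 R^d;\mathbb R))$ on $[0,\tau]$. 2. (Global uniqueness.) If an L-KS solution in $C([0,T];L^{2p}(\mathbb R^d;\mathbb R))$ exists on all of $[0,T]$, then it is unique. -/

import Mathlib

open MeasureTheory Set
open scoped ENNReal

noncomputable section

namespace KSB

/-- The real exponent `2p ≥ 1`, needed for the norm topology of `L^{2p}`. -/
instance factOneLeTwoMul (p : ℝ) [h : Fact (1 ≤ p)] : Fact (1 ≤ ENNReal.ofReal (2 * p)) :=
  ⟨by
    rw [ENNReal.one_le_ofReal]
    linarith [h.out]⟩

/-- The space `L^{2p}(ℝ^d; ℝ)` with respect to Lebesgue measure. -/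
abbrev L2p (d : ℕ) (p : ℝ) : Type :=
  Lp ℝ (ENNReal.ofReal (2 * p)) (volume : Measure (EuclideanSpace ℝ (Fin d)))

/-- The L-KS kernel `K_{t;x,y}`, i.e. the fundamental solution of `∂ₜu = -(1/8)(Δ + 2)²u`, in
Fourier form:
`(2π)^{-d} ∫_{ℝ^d} exp(-(t/8) (-2 + |ξ|²)²) cos ⟨ξ, x - y⟩ dξ`. It is only used for `t > 0`. -/
def kernel (d : ℕ) (t : ℝ) (x y : EuclideanSpace ℝ (Fin d)) : ℝ :=
  ((2 * Real.pi) ^ d)⁻¹ *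
    ∫ ξ : EuclideanSpace ℝ (Fin d),
      Real.exp (-(t / 8) * (-2 + ‖ξ‖ ^ 2) ^ 2) * Real.cos (inner ℝ ξ (x - y))

/-- The partial derivative `∂K_{t;x,y}/∂y_ℓ`. -/
def kernelDeriv (d : ℕ) (ℓ : Fin d) (t : ℝ) (x y : EuclideanSpace ℝ (Fin d)) : ℝ :=
  lineDeriv ℝ (fun z => kernel d t x z) y (EuclideanSpace.single ℓ (1 : ℝ))

/-- `U ∈ C([0,τ]; L^{2p}(ℝ^d; ℝ))` is an L-KS kernel mild solution on `[0,τ]` of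
`∂ₜU = -(1/8)(Δ + 2)²U - (1/2) ∑_ℓ ∂_ℓ(U²)`, `U(0) = u₀`. Only the values of `U` on `[0,τ]`
matter. The integrability clauses say that the integrals in the mild equation make sense. -/
structure IsMildSolution {d : ℕ} {p : ℝ} [Fact (1 ≤ p)] (u₀ : L2p d p) (τ : ℝ)
    (U : ℝ → L2p d p) : Prop where
  continuousOn : ContinuousOn U (Icc 0 τ)
  initial : U 0 = u₀
  integrable_initial : ∀ t ∈ Ioc 0 τ, ∀ᵐ x : EuclideanSpace ℝ (Fin d),
    Integrable (fun y => kernel d t x y * u₀ y)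
  integrable_space : ∀ t ∈ Ioc 0 τ, ∀ᵐ x : EuclideanSpace ℝ (Fin d), ∀ ℓ : Fin d,
    ∀ᵐ s ∂(volume.restrict (Ioc 0 t)),
      Integrable (fun y => kernelDeriv d ℓ (t - s) x y * (U s y) ^ 2)
  integrable_time : ∀ t ∈ Ioc 0 τ, ∀ᵐ x : EuclideanSpace ℝ (Fin d), ∀ ℓ : Fin d,
    IntervalIntegrable (fun s => ∫ y, kernelDeriv d ℓ (t - s) x y * (U s y) ^ 2) volume 0 t
  mild : ∀ t ∈ Ioc 0 τ, ∀ᵐ x : EuclideanSpace ℝ (Fin d),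
    U t x = (∫ y, kernel d t x y * u₀ y)
      + (1 / 2) * ∑ ℓ : Fin d, ∫ s in (0 : ℝ)..t, ∫ y,
          kernelDeriv d ℓ (t - s) x y * (U s y) ^ 2

end KSB

end

/-! The mild equation is a Duhamel equation `U = S + ∫₀ᵗ B(t-s) b(U,U) ds` in `X = L^{2p}`, with `b`
the product `L^{2p} × L^{2p} → L^p` and `B(r)` convolution with half the sum of the partial
derivatives of the kernel, from `L^p` to `L^{2p}`. If `‖B(r)‖ ≤ C r^{-α}` with `α < 1`, the
singularity is integrable: a contraction on a short interval gives existence, and a weight `e^{-lt}`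
with `l` large gives uniqueness on the whole interval at once.

The exponent comes from scaling. The gradient kernel at time `t` lives at length `ρ = t^{1/4}`, with
`L¹` norm of order at most `ρ^{-1}` and sup norm of order at most `ρ^{-(d+1)}`. Young's inequality
bounds the operator by `(‖h‖₁^{2p-1} ‖h‖_∞)^{1/(2p)}`, hence by a multiple of `t^{-(1/4 + d/(8p))}`,
and this exponent is below one exactly when `d < 6p`.

The kernel bounds come from subordination. With `r = √t` and `l = |ξ|² - 2`, the symbol
`e^{-r²l²/8}` is a Gaussian average over `σ` of `e^{-r(1-iσ)l}`, so the kernel is a superposition of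
heat kernels at the complex times `r(1-iσ)`. These have explicit Gaussian decay, which yields a
bound by `(1+|z|)^{-(d+1)}` in rescaled variables (`kernel_eq_profile`, `exists_profile_bound`).

Finally, Bochner integrals in `L^{2p}` are identified with pointwise integrals
(`coeFn_integral_Lp`), which makes the abstract equation equivalent to the stated one
(`isMildSolution_iff`). -/

noncomputable section

namespace KSB

open Filter Topology

/-! ### Duhamel integrals with an integrable singularity -/

section Duhamel

variable {X Y : Type*} [NormedAddCommGroup X] [NormedSpace ℝ X]
  [NormedAddCommGroup Y] [NormedSpace ℝ Y]
  {B : ℝ → Y →L[ℝ] X} {C α T : ℝ}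

/-- The Duhamel integral `∫₀ᵗ B(t - s) f(s) ds`. -/
def duhamel (B : ℝ → Y →L[ℝ] X) (f : ℝ → Y) (t : ℝ) : X :=
  ∫ s in (0 : ℝ)..t, B (t - s) (f s)

/-- The incomplete Gamma type integral `∫₀ᵗ r^{-α} e^{-lr} dr`. -/
def singularWeight (α l t : ℝ) : ℝ :=
  ∫ r in (0 : ℝ)..t, r ^ (-α) * Real.exp (-(l * r))

theorem intervalIntegrable_singularWeight (hα : α < 1) (l a b : ℝ) :
    IntervalIntegrable (fun r : ℝ => r ^ (-α) * Real.exp (-(l * r))) volume a b :=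
  (intervalIntegral.intervalIntegrable_rpow' (by linarith)).mul_continuousOn
    (by fun_prop)

theorem intervalIntegrable_duhamel (hα : α < 1)
    (hBc : ContinuousOn B (Ioi 0)) (hBb : ∀ r ∈ Ioc 0 T, ‖B r‖ ≤ C * r ^ (-α))
    {f : ℝ → Y} (hf : ContinuousOn f (Icc 0 T)) {t : ℝ} (ht : t ∈ Icc 0 T) :
    IntervalIntegrable (fun s => B (t - s) (f s)) volume 0 t := by
  obtain ⟨M, hM⟩ := isCompact_Icc.exists_bound_of_continuousOn hf
  have hg : IntervalIntegrable (fun s : ℝ => C * (t - s) ^ (-α) * M) volume 0 t := by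
    have h := (intervalIntegral.intervalIntegrable_rpow' (a := 0) (b := t)
      (show -1 < -α by linarith)).comp_sub_left t
    simp only [sub_zero, sub_self] at h
    exact (h.symm.const_mul C).mul_const M
  -- The open interval avoids `s = t`, where nothing is known about `B 0`.
  rw [intervalIntegrable_iff_integrableOn_Ioo_of_le ht.1] at hg ⊢
  refine Integrable.mono' hg ?_ ?_
  · refine ContinuousOn.aestronglyMeasurable ?_ measurableSet_Ioo
    refine ContinuousOn.clm_apply (hBc.comp (by fun_prop) ?_) (hf.mono ?_)
    · intro s hs
      exact sub_pos.2 hs.2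
    · exact fun s hs => ⟨hs.1.le, hs.2.le.trans ht.2⟩
  · refine (ae_restrict_iff' measurableSet_Ioo).2 (Eventually.of_forall fun s hs => ?_)
    have h1 := hBb (t - s) ⟨sub_pos.2 hs.2, by linarith [hs.1, ht.2]⟩
    exact ((B (t - s)).le_opNorm _).trans
      (mul_le_mul h1 (hM s ⟨hs.1.le, hs.2.le.trans ht.2⟩) (norm_nonneg _)
        ((norm_nonneg _).trans h1))

/-- The substitution `s = t - r` turns `e^{ls}` into `e^{lt} e^{-lr}`. The case `l = 0` serves
existence, large `l` serves uniqueness. -/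
theorem norm_duhamel_le (hα : α < 1) (hBb : ∀ r ∈ Ioc 0 T, ‖B r‖ ≤ C * r ^ (-α))
    {f : ℝ → Y} {t : ℝ} (ht : t ∈ Icc 0 T) {m l : ℝ}
    (hf : ∀ s ∈ Ioo 0 t, ‖f s‖ ≤ m * Real.exp (l * s)) :
    ‖duhamel B f t‖ ≤ C * m * Real.exp (l * t) * singularWeight α l t := by
  have hsub : duhamel B f t = ∫ r in (0 : ℝ)..t, B r (f (t - r)) := by
    have := intervalIntegral.integral_comp_sub_left (a := 0) (b := t)
      (fun r => B r (f (t - r))) t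
    simp only [sub_sub_cancel, sub_self, sub_zero] at this
    exact this
  rw [hsub, singularWeight, ← intervalIntegral.integral_const_mul]
  refine intervalIntegral.norm_integral_le_of_norm_le ht.1 ?_
    ((intervalIntegrable_singularWeight hα l 0 t).const_mul _)
  filter_upwards [Measure.ae_ne volume t] with r hrt hr
  have hr' : r < t := lt_of_le_of_ne hr.2 hrt
  have h1 := hBb r ⟨hr.1, hr.2.trans ht.2⟩
  have h2 := hf (t - r) ⟨by linarith, by linarith [hr.1]⟩
  calc ‖B r (f (t - r))‖ ≤ (C * r ^ (-α)) * (m * Real.exp (l * (t - r))) :=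
        ((B r).le_opNorm _).trans (mul_le_mul h1 h2 (norm_nonneg _) ((norm_nonneg _).trans h1))
    _ = C * m * Real.exp (l * t) * (r ^ (-α) * Real.exp (-(l * r))) := by
        rw [mul_sub, sub_eq_add_neg, Real.exp_add]; ring

/-- Extending `f` by constants and writing the integral over the fixed set `Ioc 0 T` with the
indicator of `r < t` moves all dependence on `t` into the integrand. That integrand is dominated by
the singular weight and continuous at `t₀` for each `r ≠ t₀`, so dominated convergence applies. -/
theorem continuousOn_duhamel (hT : 0 ≤ T) (hα : α < 1)
    (hBc : ContinuousOn B (Ioi 0)) (hBb : ∀ r ∈ Ioc 0 T, ‖B r‖ ≤ C * r ^ (-α))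
    {f : ℝ → Y} (hf : ContinuousOn f (Icc 0 T)) :
    ContinuousOn (duhamel B f) (Icc 0 T) := by
  obtain ⟨M, hM⟩ := isCompact_Icc.exists_bound_of_continuousOn hf
  set g : ℝ → Y := fun s => f (projIcc 0 T hT s) with hg
  have hgc : Continuous g :=
    (continuousOn_iff_continuous_domRestrict.1 hf).comp continuous_projIcc
  have hgM : ∀ s, ‖g s‖ ≤ M := fun s => hM _ (projIcc 0 T hT s).2
  have heq : EqOn (duhamel B f)
      (fun t => ∫ r in Ioc 0 T, (Iio t).indicator (fun r => B r (g (t - r))) r) (Icc 0 T) := by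
    intro t ht
    have hsub : duhamel B f t = ∫ r in (0 : ℝ)..t, B r (f (t - r)) := by
      have := intervalIntegral.integral_comp_sub_left (a := 0) (b := t)
        (fun r => B r (f (t - r))) t
      simp only [sub_sub_cancel, sub_self, sub_zero] at this
      exact this
    have hset : Ioc 0 T ∩ Iio t = Ioo 0 t := by
      ext s
      simp only [mem_inter_iff, mem_Ioc, mem_Iio, mem_Ioo]
      exact ⟨fun h => ⟨h.1.1, h.2⟩, fun h => ⟨⟨h.1, h.2.le.trans ht.2⟩, h.2⟩⟩
    simp only
    rw [hsub, setIntegral_indicator measurableSet_Iio, hset, intervalIntegral.integral_of_le ht.1,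
      integral_Ioc_eq_integral_Ioo]
    refine setIntegral_congr_fun measurableSet_Ioo fun r hr => ?_
    have : t - r ∈ Icc 0 T := ⟨by linarith [hr.2], by linarith [hr.1, ht.2]⟩
    simp [hg, projIcc_of_mem hT this]
  refine ContinuousOn.congr ?_ heq
  refine Continuous.continuousOn (continuous_iff_continuousAt.2 fun t₀ => ?_)
  have hbd : IntegrableOn (fun r : ℝ => C * r ^ (-α) * M) (Ioc 0 T) := by
    have h := (intervalIntegral.intervalIntegrable_rpow' (a := 0) (b := T)
      (show -1 < -α by linarith))
    exact ((intervalIntegrable_iff_integrableOn_Ioc_of_le hT).1 ((h.const_mul C).mul_const M))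
  refine continuousAt_of_dominated (bound := fun r => C * r ^ (-α) * M) ?_ ?_ hbd ?_
  · refine Eventually.of_forall fun t => ?_
    refine AEStronglyMeasurable.indicator ?_ measurableSet_Iio
    refine ContinuousOn.aestronglyMeasurable ?_ measurableSet_Ioc
    exact (hBc.mono fun s hs => hs.1).clm_apply (by fun_prop)
  · refine Eventually.of_forall fun t => ?_
    refine (ae_restrict_iff' measurableSet_Ioc).2 (Eventually.of_forall fun r hr => ?_)
    have h1 := hBb r hr
    refine (norm_indicator_le_norm_self _ _).trans ?_
    exact ((B r).le_opNorm _).trans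
      (mul_le_mul h1 (hgM _) (norm_nonneg _) ((norm_nonneg _).trans h1))
  · filter_upwards [ae_restrict_of_ae (Measure.ae_ne volume t₀)] with r hr
    rcases lt_or_gt_of_ne hr with h | h
    · have : (fun t => B r (g (t - r))) =ᶠ[𝓝 t₀]
          fun t => (Iio t).indicator (fun r => B r (g (t - r))) r := by
        filter_upwards [lt_mem_nhds h] with t ht
        simp [indicator_of_mem (show r ∈ Iio t from ht)]
      exact ContinuousAt.congr (by fun_prop) this
    · have : (fun _ => (0 : X)) =ᶠ[𝓝 t₀]
          fun t => (Iio t).indicator (fun r => B r (g (t - r))) r := by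
        filter_upwards [gt_mem_nhds h] with t ht
        rw [indicator_of_notMem]
        simpa using le_of_lt ht
      exact ContinuousAt.congr continuousAt_const this

/-- Over the whole half-line the integral equals `l^{-(1-α)} Γ(1-α)`, which tends to zero as `l →
∞`, uniformly in `t`. -/
theorem exists_singularWeight_le (hα : α < 1) {ε : ℝ} (hε : 0 < ε) :
    ∃ l : ℝ, 0 < l ∧ ∀ t, 0 ≤ t → singularWeight α l t ≤ ε := by
  have hlim : Tendsto (fun l : ℝ => (1 / l) ^ (1 - α) * Real.Gamma (1 - α)) atTop (𝓝 0) := by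
    have h1 : Tendsto (fun l : ℝ => 1 / l) atTop (𝓝 0) := by
      simpa using tendsto_inv_atTop_zero (𝕜 := ℝ)
    have h2 := (h1.rpow_const (p := 1 - α) (Or.inr (by linarith))).mul_const (Real.Gamma (1 - α))
    rwa [Real.zero_rpow (by linarith), zero_mul] at h2
  obtain ⟨l, hl, hl0⟩ := ((hlim.eventually_le_const hε).and (eventually_gt_atTop 0)).exists
  refine ⟨l, hl0, fun t ht => le_trans ?_ hl⟩
  have hG := Real.integral_rpow_mul_exp_neg_mul_Ioi (a := 1 - α) (by linarith) hl0
  have hint : IntegrableOn (fun r : ℝ => r ^ (1 - α - 1) * Real.exp (-(l * r))) (Ioi 0) := by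
    -- A non-integrable function would have integral zero by convention, while the Gamma value is
    -- positive.
    by_contra hcon
    rw [integral_undef hcon] at hG
    exact (mul_pos (Real.rpow_pos_of_pos (by positivity) _)
      (Real.Gamma_pos_of_pos (by linarith))).ne hG
  rw [← hG, singularWeight, intervalIntegral.integral_of_le ht]
  have he : ∀ r : ℝ, r ^ (-α) = r ^ (1 - α - 1) := fun r => by congr 1; ring
  simp only [he]
  refine setIntegral_mono_set hint ?_ (Eventually.of_forall fun r hr => hr.1)
  refine (ae_restrict_iff' measurableSet_Ioi).2 (Eventually.of_forall fun r hr => ?_)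
  exact mul_nonneg (Real.rpow_nonneg (le_of_lt hr) _) (Real.exp_pos _).le

theorem singularWeight_zero_mono (hα : α < 1) {s t : ℝ} (hs : 0 ≤ s) (hst : s ≤ t) :
    singularWeight α 0 s ≤ singularWeight α 0 t := by
  have h : ∀ r : ℝ, singularWeight α 0 r = r ^ (1 - α) / (1 - α) := fun r => by
    simp only [singularWeight, zero_mul, neg_zero, Real.exp_zero, mul_one]
    rw [integral_rpow (Or.inl (by linarith)), show -α + 1 = 1 - α by ring,
      Real.zero_rpow (by linarith), sub_zero]
  rw [h, h]
  have : 0 < 1 - α := by linarith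
  gcongr

theorem exists_singularWeight_zero_le (hα : α < 1) (hT : 0 < T) {ε : ℝ} (hε : 0 < ε) :
    ∃ τ ∈ Ioc 0 T, singularWeight α 0 τ ≤ ε := by
  have hc : Continuous (singularWeight α 0) :=
    intervalIntegral.continuous_primitive (intervalIntegrable_singularWeight hα 0) 0
  have h0 : Tendsto (singularWeight α 0) (𝓝[>] 0) (𝓝 0) := by
    have := hc.tendsto 0
    rw [show singularWeight α 0 0 = 0 by simp [singularWeight]] at this
    exact this.mono_left nhdsWithin_le_nhds
  obtain ⟨τ, h1, h2⟩ := ((h0.eventually_le_const hε).and (Ioc_mem_nhdsGT hT)).exists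
  exact ⟨τ, h2, h1⟩

end Duhamel

/-! ### Existence and uniqueness for the abstract quadratic equation -/

section QuadraticEquation

variable {X Y : Type*} [NormedAddCommGroup X] [NormedSpace ℝ X]
  [NormedAddCommGroup Y] [NormedSpace ℝ Y]
  {B : ℝ → Y →L[ℝ] X} {C α T : ℝ} {b : X →L[ℝ] X →L[ℝ] Y} {S : ℝ → X}

theorem norm_bilin_self_sub_le (b : X →L[ℝ] X →L[ℝ] Y) (u v : X) :
    ‖b u u - b v v‖ ≤ ‖b‖ * (‖u‖ + ‖v‖) * ‖u - v‖ := by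
  have h : b u u - b v v = b u (u - v) + b (u - v) v := by
    simp only [map_sub, sub_apply]; abel
  rw [h]
  refine (norm_add_le _ _).trans ?_
  have h1 := b.le_opNorm₂ u (u - v)
  have h2 := b.le_opNorm₂ (u - v) v
  linarith

theorem duhamel_bilin_sub (hα : α < 1)
    (hBc : ContinuousOn B (Ioi 0)) (hBb : ∀ r ∈ Ioc 0 T, ‖B r‖ ≤ C * r ^ (-α))
    {f g : ℝ → Y} (hf : ContinuousOn f (Icc 0 T)) (hg : ContinuousOn g (Icc 0 T))
    {t : ℝ} (ht : t ∈ Icc 0 T) :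
    duhamel B f t - duhamel B g t = duhamel B (fun s => f s - g s) t := by
  simp only [duhamel, map_sub]
  rw [intervalIntegral.integral_sub (intervalIntegrable_duhamel hα hBc hBb hf ht)
    (intervalIntegrable_duhamel hα hBc hBb hg ht)]

/-- The maximum `m` of `e^{-lt}‖U t - V t‖` over the interval satisfies `m ≤ m/2` once `l` is large
compared with the bounds on `U` and `V`. No smallness of `T` and no step-by-step continuation is
needed. -/
theorem eqOn_of_quadratic_duhamel (hT : 0 ≤ T) (hC : 0 ≤ C) (hα : α < 1)
    (hBc : ContinuousOn B (Ioi 0)) (hBb : ∀ r ∈ Ioc 0 T, ‖B r‖ ≤ C * r ^ (-α))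
    {U V : ℝ → X} (hU : ContinuousOn U (Icc 0 T)) (hV : ContinuousOn V (Icc 0 T))
    (hUe : ∀ t ∈ Icc 0 T, U t = S t + duhamel B (fun s => b (U s) (U s)) t)
    (hVe : ∀ t ∈ Icc 0 T, V t = S t + duhamel B (fun s => b (V s) (V s)) t) :
    EqOn V U (Icc 0 T) := by
  obtain ⟨M₁, hM₁⟩ := isCompact_Icc.exists_bound_of_continuousOn hU
  obtain ⟨M₂, hM₂⟩ := isCompact_Icc.exists_bound_of_continuousOn hV
  have h0T : (0 : ℝ) ∈ Icc 0 T := ⟨le_rfl, hT⟩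
  have hM₁0 : 0 ≤ M₁ := (norm_nonneg _).trans (hM₁ 0 h0T)
  have hM₂0 : 0 ≤ M₂ := (norm_nonneg _).trans (hM₂ 0 h0T)
  set K : ℝ := C * (‖b‖ * (M₁ + M₂)) with hK
  have hK0 : 0 ≤ K := by positivity
  -- The `+ 1` keeps `ε` positive when `K = 0`; in all cases `K ε ≤ 1/2`.
  obtain ⟨l, hl, hlw⟩ := exists_singularWeight_le hα (ε := 1 / (2 * (K + 1))) (by positivity)
  have hcont : ContinuousOn (fun t => Real.exp (-(l * t)) * ‖U t - V t‖) (Icc 0 T) := by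
    fun_prop
  obtain ⟨t, ht, hmax⟩ := isCompact_Icc.exists_isMaxOn ⟨0, h0T⟩ hcont
  set m : ℝ := Real.exp (-(l * t)) * ‖U t - V t‖ with hm
  have hm0 : 0 ≤ m := by positivity
  have hbound : ∀ s ∈ Icc 0 T, ‖U s - V s‖ ≤ m * Real.exp (l * s) := by
    intro s hs
    have h : Real.exp (-(l * s)) * ‖U s - V s‖ ≤ m := hmax hs
    calc ‖U s - V s‖ = (Real.exp (-(l * s)) * ‖U s - V s‖) * Real.exp (l * s) := by
          rw [mul_right_comm, ← Real.exp_add]; simp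
      _ ≤ m * Real.exp (l * s) := by gcongr
  have hbU : ContinuousOn (fun s => b (U s) (U s)) (Icc 0 T) := by fun_prop
  have hbV : ContinuousOn (fun s => b (V s) (V s)) (Icc 0 T) := by fun_prop
  have hdiff : U t - V t = duhamel B (fun s => b (U s) (U s) - b (V s) (V s)) t := by
    rw [hUe t ht, hVe t ht, add_sub_add_left_eq_sub, duhamel_bilin_sub hα hBc hBb hbU hbV ht]
  have hnorm : ‖U t - V t‖ ≤
      C * (‖b‖ * (M₁ + M₂) * m) * Real.exp (l * t) * singularWeight α l t := by
    rw [hdiff]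
    refine norm_duhamel_le hα hBb ht fun s hs => ?_
    have hs' : s ∈ Icc 0 T := ⟨hs.1.le, hs.2.le.trans ht.2⟩
    refine (norm_bilin_self_sub_le b _ _).trans ?_
    rw [mul_assoc _ m]
    have h1 := hM₁ s hs'
    have h2 := hM₂ s hs'
    exact mul_le_mul (by gcongr) (hbound s hs') (norm_nonneg _) (by positivity)
  have hle : m ≤ m / 2 := by
    calc m ≤ Real.exp (-(l * t)) *
          (C * (‖b‖ * (M₁ + M₂) * m) * Real.exp (l * t) * singularWeight α l t) := by
          rw [hm]; gcongr
      _ = K * m * singularWeight α l t * (Real.exp (-(l * t)) * Real.exp (l * t)) := by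
          rw [hK]; ring
      _ = K * m * singularWeight α l t := by rw [← Real.exp_add]; simp
      _ ≤ K * m * (1 / (2 * (K + 1))) := by
          have := hlw t ht.1
          gcongr
      _ ≤ m / 2 := by
          rw [mul_one_div, div_le_div_iff₀ (by positivity) (by positivity)]
          nlinarith
  have hmz : m = 0 := le_antisymm (by linarith) hm0
  intro s hs
  have := hbound s hs
  rw [hmz, zero_mul, norm_le_zero_iff, sub_eq_zero] at this
  exact this.symm

/-- Banach's fixed point theorem on the ball of radius `2R` in `C([0,τ]; X)`, where `R` bounds the
free term `S`. -/
theorem exists_quadratic_duhamel [CompleteSpace X] (hT : 0 < T) (hC : 0 ≤ C) (hα : α < 1)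
    (hBc : ContinuousOn B (Ioi 0)) (hBb : ∀ r ∈ Ioc 0 T, ‖B r‖ ≤ C * r ^ (-α))
    (hS : ContinuousOn S (Icc 0 T)) :
    ∃ τ ∈ Ioc 0 T, ∃ U : ℝ → X, ContinuousOn U (Icc 0 τ) ∧
      ∀ t ∈ Icc 0 τ, U t = S t + duhamel B (fun s => b (U s) (U s)) t := by
  obtain ⟨R₀, hR₀⟩ := isCompact_Icc.exists_bound_of_continuousOn hS
  set R : ℝ := |R₀| + 1 with hR
  have hRpos : 0 < R := by positivity
  have hSR : ∀ t ∈ Icc 0 T, ‖S t‖ ≤ R := fun t ht => by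
    linarith [hR₀ t ht, le_abs_self R₀]
  -- The factor `4R` serves twice: it bounds `‖u‖ + ‖v‖` in the ball, and `(2R)² = 4R · R` gives
  -- invariance of the ball.
  set K : ℝ := C * (‖b‖ * (4 * R)) with hK
  have hK0 : 0 ≤ K := by positivity
  obtain ⟨τ, hτ, hw⟩ := exists_singularWeight_zero_le hα hT (ε := 1 / (2 * (K + 1)))
    (by positivity)
  refine ⟨τ, hτ, ?_⟩
  have hsub : Icc 0 τ ⊆ Icc 0 T := Icc_subset_Icc_right hτ.2
  have hBb' : ∀ r ∈ Ioc 0 τ, ‖B r‖ ≤ C * r ^ (-α) := fun r hr => hBb r ⟨hr.1, hr.2.trans hτ.2⟩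
  have hKw : ∀ t ∈ Icc 0 τ, K * singularWeight α 0 t ≤ 1 / 2 := by
    intro t ht
    have h1 := (singularWeight_zero_mono hα ht.1 ht.2).trans hw
    calc K * singularWeight α 0 t ≤ K * (1 / (2 * (K + 1))) := by gcongr
      _ ≤ 1 / 2 := by
          rw [mul_one_div, div_le_div_iff₀ (by positivity) (by positivity)]
          nlinarith
  have hext : ∀ u : C(Icc (0 : ℝ) τ, X), Continuous (IccExtend hτ.1.le u) := fun u =>
    u.continuous.Icc_extend'
  have hbc : ∀ u : C(Icc (0 : ℝ) τ, X),
      ContinuousOn (fun s => b (IccExtend hτ.1.le u s) (IccExtend hτ.1.le u s)) (Icc 0 τ) :=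
    fun u => by have := hext u; fun_prop
  let Φ : C(Icc (0 : ℝ) τ, X) → C(Icc (0 : ℝ) τ, X) := fun u =>
    ⟨fun t => S t + duhamel B (fun s => b (IccExtend hτ.1.le u s) (IccExtend hτ.1.le u s)) t, by
      refine (hS.mono hsub).domRestrict.add ?_
      exact (continuousOn_duhamel hτ.1.le hα hBc hBb' (hbc u)).domRestrict⟩
  have hnormext : ∀ u : C(Icc (0 : ℝ) τ, X), ∀ s, ‖IccExtend hτ.1.le u s‖ ≤ ‖u‖ := fun u s =>
    u.norm_coe_le_norm _
  have hmaps : MapsTo Φ (Metric.closedBall 0 (2 * R)) (Metric.closedBall 0 (2 * R)) := by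
    intro u hu
    rw [mem_closedBall_zero_iff] at hu ⊢
    rw [ContinuousMap.norm_le _ (by positivity)]
    intro t
    have h1 : ‖duhamel B (fun s => b (IccExtend hτ.1.le u s) (IccExtend hτ.1.le u s)) t‖ ≤
        C * (‖b‖ * (2 * R) * (2 * R)) * Real.exp (0 * t) * singularWeight α 0 t := by
      refine norm_duhamel_le hα hBb' t.2 fun s _ => ?_
      have h := (hnormext u s).trans hu
      have := b.le_opNorm₂ (IccExtend hτ.1.le u s) (IccExtend hτ.1.le u s)
      rw [zero_mul, Real.exp_zero, mul_one]
      exact this.trans (by gcongr)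
    have h2 : C * (‖b‖ * (2 * R) * (2 * R)) * Real.exp (0 * t) * singularWeight α 0 t =
        R * (K * singularWeight α 0 t) := by
      rw [zero_mul, Real.exp_zero, hK]; ring
    have h3 : R * (K * singularWeight α 0 t) ≤ R * (1 / 2) := by
      have := hKw t t.2
      gcongr
    calc ‖Φ u t‖ ≤ ‖S t‖ + ‖_‖ := norm_add_le _ _
      _ ≤ R + R := add_le_add (hSR t (hsub t.2)) (by linarith)
      _ = 2 * R := by ring
  have hlip : ∀ u ∈ Metric.closedBall (0 : C(Icc (0 : ℝ) τ, X)) (2 * R),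
      ∀ v ∈ Metric.closedBall (0 : C(Icc (0 : ℝ) τ, X)) (2 * R),
      dist (Φ u) (Φ v) ≤ 1 / 2 * dist u v := by
    intro u hu v hv
    rw [mem_closedBall_zero_iff] at hu hv
    rw [ContinuousMap.dist_le (by positivity)]
    intro t
    have h1 : Φ u t - Φ v t = duhamel B (fun s => b (IccExtend hτ.1.le u s) (IccExtend hτ.1.le u s)
        - b (IccExtend hτ.1.le v s) (IccExtend hτ.1.le v s)) t := by
      rw [← duhamel_bilin_sub hα hBc hBb' (hbc u) (hbc v) t.2]
      exact add_sub_add_left_eq_sub _ _ _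
    have h2 : ‖Φ u t - Φ v t‖ ≤
        C * (‖b‖ * (4 * R) * dist u v) * Real.exp (0 * t) * singularWeight α 0 t := by
      rw [h1]
      refine norm_duhamel_le hα hBb' t.2 fun s _ => ?_
      rw [zero_mul, Real.exp_zero, mul_one]
      refine (norm_bilin_self_sub_le b _ _).trans ?_
      have h3 := (hnormext u s).trans hu
      have h4 := (hnormext v s).trans hv
      have h5 : ‖IccExtend hτ.1.le u s - IccExtend hτ.1.le v s‖ ≤ dist u v := by
        rw [← dist_eq_norm]
        exact ContinuousMap.dist_apply_le_dist _
      have h6 : ‖IccExtend hτ.1.le u s‖ + ‖IccExtend hτ.1.le v s‖ ≤ 4 * R := by linarith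
      gcongr
    rw [dist_eq_norm]
    refine h2.trans ?_
    calc C * (‖b‖ * (4 * R) * dist u v) * Real.exp (0 * t) * singularWeight α 0 t
        = (K * singularWeight α 0 t) * dist u v := by rw [zero_mul, Real.exp_zero, hK]; ring
      _ ≤ 1 / 2 * dist u v := by
        have := hKw t t.2
        gcongr
  have hcontr : ContractingWith (1 / 2) (hmaps.restrict Φ _ _) := by
    refine ⟨by rw [← NNReal.coe_lt_coe]; norm_num, LipschitzWith.of_dist_le_mul fun u v => ?_⟩
    have := hlip u u.2 v v.2
    rwa [show (1 / 2 : ℝ) = ((1 / 2 : NNReal) : ℝ) by norm_num] at this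
  obtain ⟨u, -, hfix, -⟩ := hcontr.exists_fixedPoint' (Metric.isClosed_closedBall.isComplete) hmaps
    (x := 0) (by simp [hRpos.le]) (edist_ne_top _ _)
  refine ⟨IccExtend hτ.1.le u, (hext u).continuousOn, fun t ht => ?_⟩
  have := congrArg (fun w : C(Icc (0 : ℝ) τ, X) => w ⟨t, ht⟩) hfix.symm
  rw [IccExtend_of_mem _ _ ht]
  exact this

end QuadraticEquation

/-! ### Young's inequality and convolution operators from `L^p` to `L^{2p}` -/

section Young

/-- Jensen's inequality for the measure `H dμ`, with its total mass accounting for the power `p -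
1`. -/
theorem lintegral_mul_rpow_le {α : Type*} [MeasurableSpace α] {μ : Measure α} {p : ℝ} (hp : 1 ≤ p)
    {H F : α → ℝ≥0∞} (hH : Measurable H) (hF : Measurable F) :
    (∫⁻ y, H y * F y ∂μ) ^ p ≤ (∫⁻ y, H y ∂μ) ^ (p - 1) * ∫⁻ y, H y * F y ^ p ∂μ := by
  have hp0 : 0 < p := by linarith
  have h := eLpNorm'_le_eLpNorm'_mul_rpow_measure_univ (μ := μ.withDensity H) (f := F)
    one_pos hp hF.aestronglyMeasurable
  simp only [eLpNorm', enorm_eq_self, ENNReal.rpow_one, div_one] at h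
  rw [withDensity_apply _ MeasurableSet.univ, Measure.restrict_univ,
    lintegral_withDensity_eq_lintegral_mul _ hH hF,
    lintegral_withDensity_eq_lintegral_mul _ hH (hF.pow_const p)] at h
  refine (ENNReal.rpow_le_rpow h hp0.le).trans (le_of_eq ?_)
  rw [ENNReal.mul_rpow_of_nonneg _ _ hp0.le, ← ENNReal.rpow_mul, ← ENNReal.rpow_mul,
    one_div_mul_cancel hp0.ne', ENNReal.rpow_one, mul_comm]
  congr 2
  field_simp

variable {d : ℕ}

local notation "E" => EuclideanSpace ℝ (Fin d)

theorem lintegral_conv_rpow_le {p : ℝ} (hp : 1 ≤ p) {H F : E → ℝ≥0∞} (hH : Measurable H)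
    (hF : Measurable F) (x : E) :
    (∫⁻ y, H (x - y) * F y) ^ p ≤ (∫⁻ y, H y) ^ (p - 1) * ∫⁻ y, H (x - y) * F y ^ p := by
  have h := lintegral_mul_rpow_le (μ := (volume : Measure E)) hp
    (hH.comp (measurable_const.sub measurable_id)) hF (H := fun y => H (x - y))
  rwa [lintegral_sub_left_eq_self H x] at h

theorem lintegral_conv_rpow_le_of_le {p : ℝ} (hp : 1 ≤ p) {H F : E → ℝ≥0∞} (hH : Measurable H)
    (hF : Measurable F) {M : ℝ≥0∞} (hM : ∀ x, H x ≤ M) (x : E) :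
    (∫⁻ y, H (x - y) * F y) ^ p ≤ (∫⁻ y, H y) ^ (p - 1) * M * ∫⁻ y, F y ^ p := by
  refine (lintegral_conv_rpow_le hp hH hF x).trans ?_
  rw [mul_assoc, ← lintegral_const_mul _ (hF.pow_const p)]
  gcongr
  exact hM _

/-- The power `2p` is split as `p + p`: one factor is bounded uniformly in `x` by means of `M`, the
other is integrated in `x` by Tonelli and translation invariance. -/
theorem lintegral_conv_two_rpow_le {p : ℝ} (hp : 1 ≤ p) {H F : E → ℝ≥0∞} (hH : Measurable H)
    (hF : Measurable F) {M : ℝ≥0∞} (hM : ∀ x, H x ≤ M) :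
    ∫⁻ x, (∫⁻ y, H (x - y) * F y) ^ (2 * p) ≤
      (∫⁻ y, H y) ^ (2 * p - 1) * M * (∫⁻ y, F y ^ p) ^ (2 : ℝ) := by
  set A := ∫⁻ y, H y
  set N := ∫⁻ y, F y ^ p
  have hmeas : Measurable fun z : E × E => H (z.1 - z.2) * F z.2 ^ p :=
    (hH.comp (measurable_fst.sub measurable_snd)).mul ((hF.comp measurable_snd).pow_const p)
  have hfub : ∫⁻ x, ∫⁻ y, H (x - y) * F y ^ p = A * N := by
    rw [lintegral_lintegral_swap hmeas.aemeasurable]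
    have : ∀ y : E, ∫⁻ x, H (x - y) * F y ^ p = A * F y ^ p := fun y => by
      have hHy : Measurable fun x => H (x - y) := hH.comp (measurable_id.sub_const y)
      rw [lintegral_mul_const _ hHy, lintegral_sub_right_eq_self H y]
    simp_rw [this]
    rw [lintegral_const_mul _ (hF.pow_const p)]
  calc ∫⁻ x, (∫⁻ y, H (x - y) * F y) ^ (2 * p)
      ≤ ∫⁻ x, (A ^ (p - 1) * M * N * A ^ (p - 1)) * ∫⁻ y, H (x - y) * F y ^ p := by
        refine lintegral_mono fun x => ?_
        rw [two_mul, ENNReal.rpow_add_of_nonneg _ _ (by linarith) (by linarith), mul_assoc]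
        exact mul_le_mul' (lintegral_conv_rpow_le_of_le hp hH hF hM x)
          (lintegral_conv_rpow_le hp hH hF x)
    _ = (A ^ (p - 1) * M * N * A ^ (p - 1)) * (A * N) := by
        rw [lintegral_const_mul _ hmeas.lintegral_prod_right', hfub]
    _ = A ^ (2 * p - 1) * M * N ^ (2 : ℝ) := by
        rw [show 2 * p - 1 = (p - 1) + ((p - 1) + 1) by ring,
          ENNReal.rpow_add_of_nonneg _ _ (by linarith) (by linarith),
          ENNReal.rpow_add_of_nonneg _ _ (by linarith) zero_le_one, ENNReal.rpow_one,
          ENNReal.rpow_two]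
        ring

/-- The class of convolution kernels we work with: continuous, integrable and bounded. -/
structure IsConvKernel (h : E → ℝ) : Prop where
  continuous : Continuous h
  integrable : Integrable h
  bounded : ∃ M, ∀ x, |h x| ≤ M

theorem IsConvKernel.sub {h k : E → ℝ} (hh : IsConvKernel h) (hk : IsConvKernel k) :
    IsConvKernel (fun x => h x - k x) where
  continuous := hh.continuous.sub hk.continuous
  integrable := hh.integrable.sub hk.integrable
  bounded := by
    obtain ⟨M, hM⟩ := hh.bounded
    obtain ⟨N, hN⟩ := hk.bounded
    exact ⟨M + N, fun x => (abs_sub _ _).trans (add_le_add (hM x) (hN x))⟩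

variable {p : ℝ}

instance factOneLeOfReal [h : Fact (1 ≤ p)] : Fact (1 ≤ ENNReal.ofReal p) :=
  ⟨by rw [ENNReal.one_le_ofReal]; exact h.out⟩

/-- The space `L^p(ℝ^d; ℝ)` with respect to Lebesgue measure. -/
abbrev Lreal (d : ℕ) (p : ℝ) : Type :=
  Lp ℝ (ENNReal.ofReal p) (volume : Measure (EuclideanSpace ℝ (Fin d)))

theorem lintegral_enorm_rpow_eq_of_Lp [hp : Fact (1 ≤ p)] (f : Lreal d p) :
    ∫⁻ y, ‖f y‖ₑ ^ p = ENNReal.ofReal (‖f‖ ^ p) := by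
  have hp0 : 0 < p := by linarith [hp.out]
  have h1 : eLpNorm f (ENNReal.ofReal p) volume = (∫⁻ y, ‖f y‖ₑ ^ p) ^ (1 / p) := by
    rw [eLpNorm_eq_lintegral_rpow_enorm_toReal (by simpa using hp0) ENNReal.ofReal_ne_top,
      ENNReal.toReal_ofReal hp0.le]
  have h2 : ENNReal.ofReal ‖f‖ = eLpNorm f (ENNReal.ofReal p) volume := by
    rw [Lp.norm_def, ENNReal.ofReal_toReal (Lp.eLpNorm_ne_top f)]
  rw [← ENNReal.ofReal_rpow_of_nonneg (norm_nonneg _) hp0.le, h2, h1, ← ENNReal.rpow_mul,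
    one_div_mul_cancel hp0.ne', ENNReal.rpow_one]

theorem IsConvKernel.lintegral_enorm {h : E → ℝ} (hh : IsConvKernel h) :
    ∫⁻ y, ‖h y‖ₑ = ENNReal.ofReal (∫ y, |h y|) := by
  rw [← ofReal_integral_norm_eq_lintegral_enorm hh.integrable]
  simp only [Real.norm_eq_abs]

/-- This bound holds at every `x`, so the convolution converges absolutely everywhere and not only
almost everywhere. -/
theorem IsConvKernel.lintegral_conv_le [hp : Fact (1 ≤ p)] {h : E → ℝ} (hh : IsConvKernel h)
    {A M : ℝ} (hA : ∫ y, |h y| ≤ A) (hM : ∀ x, |h x| ≤ M) (f : Lreal d p) (x : E) :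
    ∫⁻ y, ‖h (x - y) * f y‖ₑ ≤ ENNReal.ofReal ((A ^ (p - 1) * M) ^ (1 / p) * ‖f‖) := by
  have hp0 : 0 < p := by linarith [hp.out]
  have hA0 : 0 ≤ A := (integral_nonneg fun _ => abs_nonneg _).trans hA
  have hM0 : 0 ≤ M := (abs_nonneg _).trans (hM 0)
  have h1 := lintegral_conv_rpow_le_of_le hp.out (H := fun x => ‖h x‖ₑ) (F := fun x => ‖f x‖ₑ)
    hh.continuous.measurable.enorm (Lp.stronglyMeasurable f).measurable.enorm
    (M := ENNReal.ofReal M) (fun x => by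
      rw [Real.enorm_eq_ofReal_abs]; exact ENNReal.ofReal_le_ofReal (hM x)) x
  simp only [← enorm_mul] at h1
  rw [lintegral_enorm_rpow_eq_of_Lp, hh.lintegral_enorm] at h1
  have h2 : (∫⁻ y, ‖h (x - y) * f y‖ₑ) ^ p ≤
      ENNReal.ofReal ((A ^ (p - 1) * M) ^ (1 / p) * ‖f‖) ^ p := by
    refine h1.trans ?_
    rw [ENNReal.ofReal_rpow_of_nonneg (by positivity) hp0.le,
      Real.mul_rpow (by positivity) (norm_nonneg _), ← Real.rpow_mul (by positivity),
      one_div_mul_cancel hp0.ne', Real.rpow_one, ENNReal.ofReal_mul (by positivity),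
      ENNReal.ofReal_mul (by positivity),
      ← ENNReal.ofReal_rpow_of_nonneg hA0 (by linarith [hp.out])]
    have := hp.out
    gcongr
  exact (ENNReal.rpow_le_rpow_iff hp0).1 h2

theorem IsConvKernel.integrable_conv [hp : Fact (1 ≤ p)] {h : E → ℝ} (hh : IsConvKernel h)
    (f : Lreal d p) (x : E) : Integrable (fun y => h (x - y) * f y) := by
  obtain ⟨M, hM⟩ := hh.bounded
  refine ⟨((hh.continuous.comp (by fun_prop)).measurable.mul
    (Lp.stronglyMeasurable f).measurable).aestronglyMeasurable, ?_⟩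
  exact (hh.lintegral_conv_le le_rfl hM f x).trans_lt ENNReal.ofReal_lt_top

theorem IsConvKernel.abs_conv_le [hp : Fact (1 ≤ p)] {h : E → ℝ} (hh : IsConvKernel h)
    {A M : ℝ} (hA : ∫ y, |h y| ≤ A) (hM : ∀ x, |h x| ≤ M) (f : Lreal d p) (x : E) :
    |∫ y, h (x - y) * f y| ≤ (A ^ (p - 1) * M) ^ (1 / p) * ‖f‖ := by
  have hA0 : 0 ≤ A := (integral_nonneg fun _ => abs_nonneg _).trans hA
  have hM0 : 0 ≤ M := (abs_nonneg _).trans (hM 0)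
  have h1 := (enorm_integral_le_lintegral_enorm _).trans (hh.lintegral_conv_le hA hM f x)
  rw [Real.enorm_eq_ofReal_abs] at h1
  exact (ENNReal.ofReal_le_ofReal_iff (by positivity)).1 h1

theorem IsConvKernel.stronglyMeasurable_conv [Fact (1 ≤ p)] {h : E → ℝ}
    (hh : IsConvKernel h) (f : Lreal d p) : StronglyMeasurable (fun x => ∫ y, h (x - y) * f y) := by
  have : StronglyMeasurable (Function.uncurry fun x y : E => h (x - y) * f y) :=
    ((hh.continuous.comp (continuous_fst.sub continuous_snd)).measurable.mul
      ((Lp.stronglyMeasurable f).measurable.comp measurable_snd)).stronglyMeasurable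
  exact this.integral_prod_right

theorem IsConvKernel.eLpNorm_conv_le [hp : Fact (1 ≤ p)] {h : E → ℝ} (hh : IsConvKernel h)
    {A M : ℝ} (hA : ∫ y, |h y| ≤ A) (hM : ∀ x, |h x| ≤ M) (f : Lreal d p) :
    eLpNorm (fun x => ∫ y, h (x - y) * f y) (ENNReal.ofReal (2 * p)) volume ≤
      ENNReal.ofReal ((A ^ (2 * p - 1) * M) ^ (1 / (2 * p)) * ‖f‖) := by
  have hp1 := hp.out
  have hp0 : 0 < 2 * p := by linarith [hp.out]
  have hA0 : 0 ≤ A := (integral_nonneg fun _ => abs_nonneg _).trans hA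
  have hM0 : 0 ≤ M := (abs_nonneg _).trans (hM 0)
  have h1 := lintegral_conv_two_rpow_le hp.out (H := fun x => ‖h x‖ₑ) (F := fun x => ‖f x‖ₑ)
    hh.continuous.measurable.enorm (Lp.stronglyMeasurable f).measurable.enorm
    (M := ENNReal.ofReal M) (fun x => by
      rw [Real.enorm_eq_ofReal_abs]; exact ENNReal.ofReal_le_ofReal (hM x))
  simp only [← enorm_mul] at h1
  rw [lintegral_enorm_rpow_eq_of_Lp, hh.lintegral_enorm] at h1
  rw [eLpNorm_eq_lintegral_rpow_enorm_toReal (by simpa using hp0) ENNReal.ofReal_ne_top,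
      ENNReal.toReal_ofReal hp0.le, one_div, ENNReal.rpow_inv_le_iff hp0]
  calc ∫⁻ x, ‖∫ y, h (x - y) * f y‖ₑ ^ (2 * p)
      ≤ ∫⁻ x, (∫⁻ y, ‖h (x - y) * f y‖ₑ) ^ (2 * p) := by
        refine lintegral_mono fun x => ?_
        gcongr
        exact enorm_integral_le_lintegral_enorm _
    _ ≤ _ := h1
    _ ≤ _ := by
      have hf2 : ENNReal.ofReal (‖f‖ ^ p) ^ (2 : ℝ) = ENNReal.ofReal (‖f‖ ^ (2 * p)) := by
        rw [ENNReal.ofReal_rpow_of_nonneg (by positivity) (by norm_num),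
          ← Real.rpow_mul (norm_nonneg _), mul_comm p 2]
      rw [ENNReal.ofReal_rpow_of_nonneg (by positivity) hp0.le,
        Real.mul_rpow (by positivity) (norm_nonneg _), ← Real.rpow_mul (by positivity),
        inv_mul_cancel₀ hp0.ne', Real.rpow_one, ENNReal.ofReal_mul (by positivity),
        ENNReal.ofReal_mul (by positivity),
        ← ENNReal.ofReal_rpow_of_nonneg hA0 (by linarith), hf2]
      have : 0 ≤ 2 * p - 1 := by linarith
      gcongr

theorem IsConvKernel.memLp_conv [hp : Fact (1 ≤ p)] {h : E → ℝ} (hh : IsConvKernel h) (f : Lreal d p) :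
    MemLp (fun x => ∫ y, h (x - y) * f y) (ENNReal.ofReal (2 * p)) volume := by
  obtain ⟨M, hM⟩ := hh.bounded
  exact ⟨(hh.stronglyMeasurable_conv f).aestronglyMeasurable,
    (hh.eLpNorm_conv_le le_rfl hM f).trans_lt ENNReal.ofReal_lt_top⟩

open Classical in
/-- Convolution with `h` as a continuous linear map `L^p → L^{2p}`. -/
def convL (p : ℝ) [Fact (1 ≤ p)] (h : E → ℝ) : Lreal d p →L[ℝ] L2p d p :=
  if hh : IsConvKernel h then
    LinearMap.mkContinuousOfExistsBound
      { toFun := fun f => (hh.memLp_conv f).toLp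
        map_add' := fun f g => by
          rw [← MemLp.toLp_add]
          refine MemLp.toLp_congr _ _ (Eventually.of_forall fun x => ?_)
          rw [Pi.add_apply, ← integral_add (hh.integrable_conv f x) (hh.integrable_conv g x)]
          refine integral_congr_ae ?_
          filter_upwards [Lp.coeFn_add f g] with y hy
          rw [hy, Pi.add_apply, mul_add]
        map_smul' := fun c f => by
          rw [RingHom.id_apply, ← MemLp.toLp_const_smul]
          refine MemLp.toLp_congr _ _ (Eventually.of_forall fun x => ?_)
          rw [Pi.smul_apply, smul_eq_mul, ← integral_const_mul]
          refine integral_congr_ae ?_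
          filter_upwards [Lp.coeFn_smul c f] with y hy
          rw [hy, Pi.smul_apply, smul_eq_mul]
          ring }
      (by
        obtain ⟨M, hM⟩ := hh.bounded
        have hM0 : 0 ≤ M := (abs_nonneg _).trans (hM 0)
        have hA0 : 0 ≤ ∫ y, |h y| := integral_nonneg fun _ => abs_nonneg _
        refine ⟨((∫ y, |h y|) ^ (2 * p - 1) * M) ^ (1 / (2 * p)), fun f => ?_⟩
        simp only [LinearMap.coe_mk, AddHom.coe_mk, Lp.norm_toLp]
        exact ENNReal.toReal_le_of_le_ofReal (by positivity) (hh.eLpNorm_conv_le le_rfl hM f))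
  -- The default value makes the operator total in `h`, so that time-dependent families need no
  -- proof argument.
  else 0

theorem IsConvKernel.coeFn_convL [Fact (1 ≤ p)] {h : E → ℝ} (hh : IsConvKernel h) (f : Lreal d p) :
    convL p h f =ᵐ[volume] fun x => ∫ y, h (x - y) * f y := by
  rw [convL, dif_pos hh]
  exact (hh.memLp_conv f).coeFn_toLp

theorem IsConvKernel.norm_convL_le [hp : Fact (1 ≤ p)] {h : E → ℝ} (hh : IsConvKernel h)
    {A M : ℝ} (hA : ∫ y, |h y| ≤ A) (hM : ∀ x, |h x| ≤ M) :
    ‖convL p h‖ ≤ (A ^ (2 * p - 1) * M) ^ (1 / (2 * p)) := by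
  have hA0 : 0 ≤ A := (integral_nonneg fun _ => abs_nonneg _).trans hA
  have hM0 : 0 ≤ M := (abs_nonneg _).trans (hM 0)
  refine ContinuousLinearMap.opNorm_le_bound _ (by positivity) fun f => ?_
  rw [Lp.norm_def, eLpNorm_congr_ae (hh.coeFn_convL f)]
  exact ENNReal.toReal_le_of_le_ofReal (by positivity) (hh.eLpNorm_conv_le hA hM f)

theorem convL_sub [Fact (1 ≤ p)] {h k : E → ℝ} (hh : IsConvKernel h) (hk : IsConvKernel k) :
    convL p h - convL p k = convL p (fun x => h x - k x) := by
  ext1 f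
  refine Lp.ext ?_
  rw [sub_apply]
  filter_upwards [Lp.coeFn_sub (convL p h f) (convL p k f), hh.coeFn_convL f, hk.coeFn_convL f,
    (hh.sub hk).coeFn_convL f] with x h1 h2 h3 h4
  rw [h1, Pi.sub_apply, h2, h3, h4, ← integral_sub (hh.integrable_conv f x)
    (hk.integrable_conv f x)]
  simp only [sub_mul]

end Young

/-! ### Pointwise evaluation of Bochner integrals in `L^q` -/

section BochnerLp

variable {S β : Type*} [MeasurableSpace S] [MeasurableSpace β] {μ : Measure S} {ν : Measure β}
  {q : ℝ≥0∞}

theorem integrableOn_coeFn_Lp [Fact (1 ≤ q)] {A : Set β} (hA : ν A < ∞) (u : Lp ℝ q ν) :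
    IntegrableOn u A ν := by
  have : IsFiniteMeasure (ν.restrict A) := ⟨by simpa using hA⟩
  exact ((Lp.memLp u).restrict A).integrable Fact.out

theorem setIntegral_norm_Lp_le [Fact (1 ≤ q)] {A : Set β} (hA : ν A < ∞) (u : Lp ℝ q ν) :
    ∫ x in A, ‖u x‖ ∂ν ≤ (ν A ^ (1 - 1 / q.toReal)).toReal * ‖u‖ := by
  have hq : (1 : ℝ≥0∞) ≤ q := Fact.out
  have hq' : 0 ≤ 1 - 1 / q.toReal := by
    rcases eq_or_ne q ∞ with rfl | hqt
    · simp
    · have : 1 ≤ q.toReal := by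
        rw [← ENNReal.toReal_one]
        exact ENNReal.toReal_mono hqt hq
      rw [sub_nonneg, div_le_one (by linarith)]
      exact this
  have h1 := eLpNorm_le_eLpNorm_mul_rpow_measure_univ (μ := ν.restrict A) hq
    (Lp.aestronglyMeasurable u).restrict
  rw [Measure.restrict_apply_univ, ENNReal.toReal_one, div_one, eLpNorm_one_eq_lintegral_enorm] at h1
  have h2 : eLpNorm u q (ν.restrict A) ≤ ENNReal.ofReal ‖u‖ := by
    rw [Lp.norm_def, ENNReal.ofReal_toReal (Lp.eLpNorm_ne_top u)]
    exact eLpNorm_mono_measure _ Measure.restrict_le_self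
  rw [integral_norm_eq_lintegral_enorm (Lp.aestronglyMeasurable u).restrict]
  refine ENNReal.toReal_le_of_le_ofReal (by positivity) (h1.trans ?_)
  rw [ENNReal.ofReal_mul (by positivity), ENNReal.ofReal_toReal, mul_comm]
  · gcongr
  · exact (ENNReal.rpow_lt_top_of_nonneg hq' hA.ne).ne

/-- Integration over a set of finite measure as a continuous linear functional on `L^q`. -/
def setIntegralL [Fact (1 ≤ q)] {A : Set β} (hA : ν A < ∞) : Lp ℝ q ν →L[ℝ] ℝ :=
  LinearMap.mkContinuous
    { toFun := fun u => ∫ x in A, u x ∂ν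
      map_add' := fun u v => by
        rw [← integral_add (integrableOn_coeFn_Lp hA u) (integrableOn_coeFn_Lp hA v)]
        exact integral_congr_ae (ae_restrict_of_ae (Lp.coeFn_add u v))
      map_smul' := fun c u => by
        rw [RingHom.id_apply, ← integral_smul]
        exact integral_congr_ae (ae_restrict_of_ae (Lp.coeFn_smul c u)) }
    (ν A ^ (1 - 1 / q.toReal)).toReal
    fun u => (norm_integral_le_integral_norm _).trans (setIntegral_norm_Lp_le hA u)

theorem setIntegralL_apply [Fact (1 ≤ q)] {A : Set β} (hA : ν A < ∞) (u : Lp ℝ q ν) :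
    setIntegralL hA u = ∫ x in A, u x ∂ν := rfl

/-- The Bochner integral of an `L^q`-valued function can be computed pointwise. -/
theorem coeFn_integral_Lp [SFinite μ] [SigmaFinite ν] [Fact (1 ≤ q)]
    {F : S → Lp ℝ q ν} (hF : Integrable F μ) {f : S → β → ℝ}
    (hf : AEStronglyMeasurable (Function.uncurry f) (μ.prod ν))
    (hFf : ∀ᵐ s ∂μ, F s =ᵐ[ν] f s) :
    ∀ᵐ x ∂ν, Integrable (fun s => f s x) μ ∧ (∫ s, F s ∂μ : Lp ℝ q ν) x = ∫ s, f s x ∂μ := by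
  -- On a set of finite measure `L^q` embeds in `L¹`, so Bochner integrability of `F` gives joint
  -- integrability of `f` and Fubini becomes available.
  have key : ∀ A : Set β, ν A < ∞ → Integrable (Function.uncurry f) (μ.prod (ν.restrict A)) := by
    intro A hA
    have hm : AEStronglyMeasurable (Function.uncurry f) (μ.prod (ν.restrict A)) := by
      have := hf.restrict (s := univ ×ˢ A)
      rwa [← Measure.prod_restrict, Measure.restrict_univ] at this
    rw [integrable_prod_iff hm]
    constructor
    · filter_upwards [hFf] with s hs
      exact (integrableOn_coeFn_Lp hA (F s)).congr (ae_restrict_of_ae hs)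
    · refine Integrable.mono' (hF.norm.const_mul (ν A ^ (1 - 1 / q.toReal)).toReal)
        hm.norm.integral_prod_right' ?_
      filter_upwards [hFf] with s hs
      rw [Real.norm_of_nonneg (integral_nonneg fun _ => norm_nonneg _)]
      refine le_trans (le_of_eq ?_) (setIntegral_norm_Lp_le hA (F s))
      refine integral_congr_ae (ae_restrict_of_ae ?_)
      filter_upwards [hs] with x hx
      rw [hx, Function.uncurry_apply_pair]
  -- Sigma-finiteness reduces the claim to sets of finite measure. There both sides have the same
  -- integral over every measurable subset: the functional `setIntegralL` commutes with the Bochner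
  -- integral, and Fubini handles the pointwise one.
  refine ae_of_forall_measure_lt_top_ae_restrict _ fun A hA hAtop => ?_
  have hintA := key A hAtop
  refine Eventually.and ?_ ?_
  · exact hintA.prod_left_ae
  · refine Integrable.ae_eq_of_forall_setIntegral_eq _ _ (integrableOn_coeFn_Lp hAtop _)
      hintA.integral_prod_right fun s hs _ => ?_
    have hsA : ν (s ∩ A) < ∞ := (measure_mono inter_subset_right).trans_lt hAtop
    rw [Measure.restrict_restrict hs, ← setIntegralL_apply hsA,
      ← ContinuousLinearMap.integral_comp_comm _ hF]
    have hsw := integral_integral_swap (f := f) (key (s ∩ A) hsA)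
    rw [← hsw]
    refine integral_congr_ae ?_
    filter_upwards [hFf] with t ht
    rw [setIntegralL_apply]
    exact integral_congr_ae (ae_restrict_of_ae ht)

end BochnerLp

/-! ### Translations on `L^{2p}` -/

section Translation

variable {d : ℕ} {p : ℝ}

local notation "E" => EuclideanSpace ℝ (Fin d)

/-- Translations are strongly continuous on `L^q` for finite `q` but not on `L^∞`; this instance
supplies the finiteness. -/
instance factNeTop : Fact (ENNReal.ofReal (2 * p) ≠ ∞) := ⟨ENNReal.ofReal_ne_top⟩

/-- The translate `x ↦ u (a + x)` of `u ∈ L^{2p}`. -/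
def translate (a : E) (u : L2p d p) : L2p d p := DomAddAct.mk a +ᵥ u

theorem coeFn_translate (a : E) (u : L2p d p) :
    translate a u =ᵐ[volume] fun x => u (a + x) :=
  DomAddAct.vadd_Lp_ae_eq (DomAddAct.mk a) u

theorem norm_translate (a : E) (u : L2p d p) : ‖translate a u‖ = ‖u‖ :=
  DomAddAct.norm_vadd_Lp (DomAddAct.mk a) u

theorem translate_zero (u : L2p d p) : translate (0 : E) u = u :=
  zero_vadd _ u

theorem continuous_translate [Fact (1 ≤ p)] (u : L2p d p) : Continuous fun a : E => translate a u := by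
  unfold translate
  exact (DomAddAct.continuous_mk).vadd continuous_const

end Translation

/-! ### Complex Gaussians and decay of the rescaled kernels -/

section Profile

variable {d : ℕ}

local notation "E" => EuclideanSpace ℝ (Fin d)

/-- The integrable weight `(1 + |z|)^{-(d+1)}` dominating all rescaled kernels. -/
def decay (z : E) : ℝ := ((1 + ‖z‖) ^ (d + 1))⁻¹

theorem decay_pos (z : E) : 0 < decay z := by unfold decay; positivity

theorem decay_le_one (z : E) : decay z ≤ 1 := by
  unfold decay
  exact inv_le_one_of_one_le₀ (one_le_pow₀ (by linarith [norm_nonneg z]))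

theorem decay_anti {z z' : E} (h : ‖z‖ ≤ ‖z'‖) : decay z' ≤ decay z := by
  unfold decay
  gcongr

theorem continuous_decay : Continuous (decay (d := d)) := by
  unfold decay
  exact Continuous.inv₀ (by fun_prop) fun z => by positivity

theorem integrable_decay : Integrable (decay (d := d)) := by
  have h := integrable_one_add_norm (μ := (volume : Measure E)) (r := (d + 1 : ℝ)) (by simp)
  refine h.congr (Eventually.of_forall fun z => ?_)
  simp only [decay]
  rw [Real.rpow_neg (by positivity)]
  norm_cast

/-- The complex time direction `1 - iσ`. -/
def complexTime (σ : ℝ) : ℂ := 1 - σ * Complex.I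

theorem complexTime_re (σ : ℝ) : (complexTime σ).re = 1 := by simp [complexTime]

theorem complexTime_im (σ : ℝ) : (complexTime σ).im = -σ := by simp [complexTime]

theorem complexTime_ne_zero (σ : ℝ) : complexTime σ ≠ 0 := fun h => by
  have := complexTime_re σ
  simp [h] at this

theorem one_le_norm_complexTime (σ : ℝ) : 1 ≤ ‖complexTime σ‖ := by
  have := Complex.abs_re_le_norm (complexTime σ)
  rwa [complexTime_re, abs_one] at this

theorem continuous_complexTime : Continuous complexTime := by
  unfold complexTime
  fun_prop

theorem normSq_complexTime (σ : ℝ) : Complex.normSq (complexTime σ) = 1 + σ ^ 2 := by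
  rw [Complex.normSq_apply, complexTime_re, complexTime_im]; ring

/-- The amplitude of the complex Gaussians in the subordination formula. -/
def amplitude (d : ℕ) (r σ : ℝ) : ℂ :=
  Complex.exp (-2 * (σ + Complex.I) ^ 2 - 2 * r * σ * Complex.I) *
    (Real.pi / complexTime σ) ^ (d / 2 : ℂ)

/-- The integrand of the subordination formula: a complex Gaussian in `z`. -/
def gaussianProfile (d : ℕ) (r : ℝ) (z : E) (σ : ℝ) : ℂ :=
  amplitude d r σ * Complex.exp (-(‖z‖ : ℂ) ^ 2 / (4 * complexTime σ))

/-- The shift by `i` costs only the factor `e²`, and the term in `r` is purely imaginary, so the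
bound is uniform in `r`. -/
theorem norm_exp_amplitude (r σ : ℝ) :
    ‖Complex.exp (-2 * (σ + Complex.I) ^ 2 - 2 * r * σ * Complex.I)‖ =
      Real.exp (2 - 2 * σ ^ 2) := by
  rw [Complex.norm_exp]
  congr 1
  simp [pow_two]
  ring

theorem norm_pi_div_complexTime_cpow_le (σ : ℝ) :
    ‖(Real.pi / complexTime σ : ℂ) ^ (d / 2 : ℂ)‖ ≤ Real.pi ^ (d / 2 : ℝ) := by
  have h : (d / 2 : ℂ) = ((d / 2 : ℝ) : ℂ) := by push_cast; rfl
  rw [h, Complex.norm_cpow_real, norm_div, Complex.norm_real, Real.norm_of_nonneg Real.pi_pos.le]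
  have := one_le_norm_complexTime σ
  gcongr
  exact div_le_self Real.pi_pos.le this

theorem norm_exp_gaussian (z : E) (σ : ℝ) :
    ‖Complex.exp (-(‖z‖ : ℂ) ^ 2 / (4 * complexTime σ))‖ =
      Real.exp (-(‖z‖ ^ 2 / (4 * (1 + σ ^ 2)))) := by
  rw [Complex.norm_exp]
  congr 1
  have h : -(‖z‖ : ℂ) ^ 2 / (4 * complexTime σ) =
      ((-‖z‖ ^ 2 / 4 : ℝ) : ℂ) * (complexTime σ)⁻¹ := by
    push_cast
    field_simp
  rw [h, Complex.re_ofReal_mul, Complex.inv_re, complexTime_re, normSq_complexTime]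
  field_simp

theorem continuous_pi_div_complexTime_cpow :
    Continuous fun σ : ℝ => (Real.pi / complexTime σ : ℂ) ^ (d / 2 : ℂ) := by
  -- The base has positive real part and so stays off the branch cut.
  refine Continuous.cpow (continuous_const.div continuous_complexTime complexTime_ne_zero)
    continuous_const fun σ => Or.inl ?_
  rw [div_eq_mul_inv, Complex.re_ofReal_mul, Complex.inv_re, complexTime_re, normSq_complexTime]
  have := Real.pi_pos
  positivity

theorem continuous_gaussianProfile :
    Continuous fun q : (ℝ × E) × ℝ => gaussianProfile d q.1.1 q.1.2 q.2 := by
  unfold gaussianProfile amplitude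
  have h1 : Continuous fun q : (ℝ × E) × ℝ => (Real.pi / complexTime q.2 : ℂ) ^ (d / 2 : ℂ) :=
    continuous_pi_div_complexTime_cpow.comp continuous_snd
  have h2 : Continuous fun q : (ℝ × E) × ℝ => -(‖q.1.2‖ : ℂ) ^ 2 / (4 * complexTime q.2) := by
    refine Continuous.div (by fun_prop)
      (continuous_const.mul (continuous_complexTime.comp continuous_snd)) fun q => ?_
    exact mul_ne_zero (by norm_num) (complexTime_ne_zero _)
  fun_prop

/-- With `u = x²/(4a)`, `(1+x)²` is at most `8a(1+u)`, and `(1+u)^n` is absorbed by `e^u`. The loss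
`a^n` is kept explicit, since `a = 1 + σ²` will vary. -/
theorem pow_mul_exp_neg_gaussian_le (n : ℕ) {a : ℝ} (ha : 1 ≤ a) {x : ℝ} (hx : 0 ≤ x) :
    (1 + x) ^ (2 * n) * Real.exp (-(x ^ 2 / (4 * a))) ≤
      (8 * a) ^ n * (n.factorial * Real.exp 1) := by
  set u := x ^ 2 / (4 * a) with hu
  have hu0 : 0 ≤ u := by positivity
  have hxu : x ^ 2 = 4 * a * u := by rw [hu]; field_simp
  have h1 : (1 + x) ^ 2 ≤ 8 * a * (1 + u) := by nlinarith [sq_nonneg (1 - x)]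
  have h2 : (1 + u) ^ n ≤ n.factorial * Real.exp (1 + u) := by
    have := Real.pow_div_factorial_le_exp (x := 1 + u) (by positivity) n
    rw [div_le_iff₀ (by positivity)] at this
    linarith
  calc (1 + x) ^ (2 * n) * Real.exp (-u) = ((1 + x) ^ 2) ^ n * Real.exp (-u) := by rw [pow_mul]
    _ ≤ (8 * a * (1 + u)) ^ n * Real.exp (-u) := by gcongr
    _ = (8 * a) ^ n * ((1 + u) ^ n * Real.exp (-u)) := by rw [mul_pow]; ring
    _ ≤ (8 * a) ^ n * ((n.factorial * Real.exp (1 + u)) * Real.exp (-u)) := by gcongr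
    _ = (8 * a) ^ n * (n.factorial * Real.exp 1) := by
        rw [mul_assoc (n.factorial : ℝ), ← Real.exp_add]
        simp

/-- The Gaussian in `z` widens as `σ` grows, which costs `(1+σ²)^n`; half of the factor `e^{-2σ²}`
pays for it. The weight `1 + ‖z‖` leaves room for the multiplier produced by a derivative. -/
theorem exists_gaussianProfile_bound (d : ℕ) :
    ∃ C : ℝ, 0 ≤ C ∧ ∀ (r : ℝ) (z : EuclideanSpace ℝ (Fin d)) (σ : ℝ),
      (1 + ‖z‖) * ‖gaussianProfile d r z σ‖ ≤ C * decay z * Real.exp (-σ ^ 2) := by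
  -- The power `2n` must reach `d + 2`: `d + 1` for `decay` and one for the extra weight.
  set n := d + 1 with hn
  set L : ℝ := n.factorial * Real.exp 1 with hL
  have hL0 : 0 ≤ L := by positivity
  refine ⟨Real.exp 2 * Real.pi ^ (d / 2 : ℝ) * 8 ^ n * L * L, by positivity, fun r z σ => ?_⟩
  have h1 : ‖gaussianProfile d r z σ‖ ≤ Real.exp (2 - 2 * σ ^ 2) * Real.pi ^ (d / 2 : ℝ) *
      Real.exp (-(‖z‖ ^ 2 / (4 * (1 + σ ^ 2)))) := by
    rw [gaussianProfile, amplitude, norm_mul, norm_mul, norm_exp_amplitude, norm_exp_gaussian]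
    gcongr
    exact norm_pi_div_complexTime_cpow_le σ
  have h2 := pow_mul_exp_neg_gaussian_le n (a := 1 + σ ^ 2) (by nlinarith [sq_nonneg σ])
    (norm_nonneg z)
  have h3 : (1 + σ ^ 2) ^ n ≤ L * Real.exp (σ ^ 2) := by
    have := Real.pow_div_factorial_le_exp (x := 1 + σ ^ 2) (by positivity) n
    rw [div_le_iff₀ (by positivity), Real.exp_add] at this
    rw [hL]
    linarith
  have hz1 : 1 ≤ 1 + ‖z‖ := by linarith [norm_nonneg z]
  have h4 : (1 + ‖z‖) * (1 + ‖z‖) ^ (d + 1) ≤ (1 + ‖z‖) ^ (2 * n) := by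
    rw [← pow_succ']
    exact pow_le_pow_right₀ hz1 (by omega)
  have hexp : Real.exp (2 - 2 * σ ^ 2) * Real.exp (σ ^ 2) = Real.exp 2 * Real.exp (-σ ^ 2) := by
    rw [← Real.exp_add, ← Real.exp_add]; congr 1; ring
  have hpos : 0 < (1 + ‖z‖) ^ (d + 1) := by positivity
  rw [decay, mul_assoc, inv_mul_eq_div, ← mul_div_assoc, le_div_iff₀ hpos]
  calc (1 + ‖z‖) * ‖gaussianProfile d r z σ‖ * (1 + ‖z‖) ^ (d + 1)
      = ((1 + ‖z‖) * (1 + ‖z‖) ^ (d + 1)) * ‖gaussianProfile d r z σ‖ := by ring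
    _ ≤ (1 + ‖z‖) ^ (2 * n) * (Real.exp (2 - 2 * σ ^ 2) * Real.pi ^ (d / 2 : ℝ) *
          Real.exp (-(‖z‖ ^ 2 / (4 * (1 + σ ^ 2))))) := by gcongr
    _ = Real.exp (2 - 2 * σ ^ 2) * Real.pi ^ (d / 2 : ℝ) * ((1 + ‖z‖) ^ (2 * n) *
          Real.exp (-(‖z‖ ^ 2 / (4 * (1 + σ ^ 2))))) := by ring
    _ ≤ Real.exp (2 - 2 * σ ^ 2) * Real.pi ^ (d / 2 : ℝ) * ((8 * (1 + σ ^ 2)) ^ n * L) := by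
        gcongr
    _ = Real.exp (2 - 2 * σ ^ 2) * Real.pi ^ (d / 2 : ℝ) * (8 ^ n * (1 + σ ^ 2) ^ n * L) := by
        rw [mul_pow]
    _ ≤ Real.exp (2 - 2 * σ ^ 2) * Real.pi ^ (d / 2 : ℝ) *
          (8 ^ n * (L * Real.exp (σ ^ 2)) * L) := by gcongr
    _ = Real.pi ^ (d / 2 : ℝ) * 8 ^ n * L * L *
          (Real.exp (2 - 2 * σ ^ 2) * Real.exp (σ ^ 2)) := by ring
    _ = Real.exp 2 * Real.pi ^ (d / 2 : ℝ) * 8 ^ n * L * L * Real.exp (-σ ^ 2) := by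
        rw [hexp]; ring

theorem integrable_exp_neg_sq : Integrable fun σ : ℝ => Real.exp (-σ ^ 2) := by
  simpa using integrable_exp_neg_mul_sq (b := 1) one_pos

/-- The normalizing constant `(π/2)^{-1/2}` of the subordination formula. -/
def subordConst : ℂ := ((Real.pi / 2 : ℂ) ^ (1 / 2 : ℂ))⁻¹

/-- Rescaled kernels: superpositions of complex Gaussians with a multiplier `θ`. -/
def profile (d : ℕ) (θ : EuclideanSpace ℝ (Fin d) → ℝ → ℂ) (r : ℝ)
    (z : EuclideanSpace ℝ (Fin d)) : ℝ :=
  Real.exp (2 * r) * ((2 * Real.pi) ^ d)⁻¹ *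
    (subordConst * ∫ σ, gaussianProfile d r z σ * θ z σ).re

/-- Multipliers of at most linear growth in the space variable. -/
structure IsMultiplier (θ : E → ℝ → ℂ) : Prop where
  continuous : Continuous (Function.uncurry θ)
  norm_le : ∀ z σ, ‖θ z σ‖ ≤ 1 + ‖z‖

theorem exists_gaussianProfile_mul_bound (d : ℕ) :
    ∃ C : ℝ, 0 ≤ C ∧ ∀ (θ : EuclideanSpace ℝ (Fin d) → ℝ → ℂ), IsMultiplier θ → ∀ r z σ,
      ‖gaussianProfile d r z σ * θ z σ‖ ≤ C * decay z * Real.exp (-σ ^ 2) := by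
  obtain ⟨C, hC, h⟩ := exists_gaussianProfile_bound d
  refine ⟨C, hC, fun θ hθ r z σ => le_trans ?_ (h r z σ)⟩
  rw [norm_mul, mul_comm]
  gcongr
  exact hθ.norm_le z σ

theorem IsMultiplier.continuous_integrand {θ : E → ℝ → ℂ} (hθ : IsMultiplier θ) :
    Continuous fun q : (ℝ × E) × ℝ => gaussianProfile d q.1.1 q.1.2 q.2 * θ q.1.2 q.2 :=
  continuous_gaussianProfile.mul
    (hθ.continuous.comp (by fun_prop : Continuous fun q : (ℝ × E) × ℝ => (q.1.2, q.2)))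

theorem IsMultiplier.integrable_integrand {θ : E → ℝ → ℂ} (hθ : IsMultiplier θ) (r : ℝ) (z : E) :
    Integrable fun σ => gaussianProfile d r z σ * θ z σ := by
  obtain ⟨C, hC, h⟩ := exists_gaussianProfile_mul_bound d
  refine Integrable.mono' (integrable_exp_neg_sq.const_mul (C * decay z)) ?_
    (Eventually.of_forall fun σ => h θ hθ r z σ)
  exact (hθ.continuous_integrand.comp
    (by fun_prop : Continuous fun σ : ℝ => ((r, z), σ))).aestronglyMeasurable

theorem IsMultiplier.continuous_profile {θ : E → ℝ → ℂ} (hθ : IsMultiplier θ) :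
    Continuous fun q : ℝ × E => profile d θ q.1 q.2 := by
  obtain ⟨C, hC, h⟩ := exists_gaussianProfile_mul_bound d
  have : Continuous fun q : ℝ × E => ∫ σ, gaussianProfile d q.1 q.2 σ * θ q.2 σ := by
    refine continuous_of_dominated (bound := fun σ => C * Real.exp (-σ ^ 2))
      (fun q => (hθ.integrable_integrand q.1 q.2).aestronglyMeasurable)
      (fun q => Eventually.of_forall fun σ => ?_) (integrable_exp_neg_sq.const_mul C)
      (Eventually.of_forall fun σ => ?_)
    · refine (h θ hθ q.1 q.2 σ).trans ?_
      have := decay_le_one q.2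
      gcongr
      exact mul_le_of_le_one_right hC this
    · have hc : Continuous fun q : ℝ × E => (q, σ) := by fun_prop
      have := hθ.continuous_integrand.comp hc
      exact this
  unfold profile
  fun_prop

theorem exists_profile_bound (d : ℕ) :
    ∃ C : ℝ, 0 ≤ C ∧ ∀ (θ : EuclideanSpace ℝ (Fin d) → ℝ → ℂ), IsMultiplier θ → ∀ r z,
      |profile d θ r z| ≤ C * Real.exp (2 * r) * decay z := by
  obtain ⟨C, hC, h⟩ := exists_gaussianProfile_mul_bound d
  have hG : 0 ≤ ∫ σ : ℝ, Real.exp (-σ ^ 2) := integral_nonneg fun _ => (Real.exp_pos _).le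
  have hpi : 0 ≤ ((2 * Real.pi) ^ d)⁻¹ := by have := Real.pi_pos; positivity
  refine ⟨((2 * Real.pi) ^ d)⁻¹ * ‖subordConst‖ * C * ∫ σ : ℝ, Real.exp (-σ ^ 2), by positivity,
    fun θ hθ r z => ?_⟩
  have h1 : ‖∫ σ, gaussianProfile d r z σ * θ z σ‖ ≤
      C * decay z * ∫ σ : ℝ, Real.exp (-σ ^ 2) := by
    rw [← integral_const_mul]
    exact norm_integral_le_of_norm_le (integrable_exp_neg_sq.const_mul _)
      (Eventually.of_forall fun σ => h θ hθ r z σ)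
  rw [profile, abs_mul, abs_of_nonneg (by positivity)]
  calc _ ≤ Real.exp (2 * r) * ((2 * Real.pi) ^ d)⁻¹ *
        (‖subordConst‖ * (C * decay z * ∫ σ : ℝ, Real.exp (-σ ^ 2))) := by
        gcongr
        refine (Complex.abs_re_le_norm _).trans ?_
        rw [norm_mul]
        gcongr
    _ = _ := by ring

theorem isMultiplier_one : IsMultiplier (fun (_ : E) (_ : ℝ) => (1 : ℂ)) where
  continuous := continuous_const
  norm_le z σ := by simp

/-- The multiplier `z_ℓ / (2(1 - iσ))` which appears on differentiating the Gaussians. -/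
def gradMultiplier (ℓ : Fin d) (z : E) (σ : ℝ) : ℂ := (z ℓ : ℂ) / (2 * complexTime σ)

theorem isMultiplier_gradMultiplier (ℓ : Fin d) : IsMultiplier (gradMultiplier (d := d) ℓ) where
  continuous := by
    refine Continuous.div (by fun_prop)
      (continuous_const.mul (continuous_complexTime.comp continuous_snd)) fun q => ?_
    exact mul_ne_zero (by norm_num) (complexTime_ne_zero _)
  norm_le z σ := by
    rw [gradMultiplier, norm_div, norm_mul, Complex.norm_real, RCLike.norm_ofNat]
    have h1 := one_le_norm_complexTime σ
    have h2 := PiLp.norm_apply_le z ℓ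
    rw [div_le_iff₀ (by positivity)]
    nlinarith [norm_nonneg z]

end Profile

/-! ### Subordination formula, mass and derivative of the kernel -/

section KernelFormula

variable {d : ℕ}

local notation "E" => EuclideanSpace ℝ (Fin d)

/-- A positive real factor does not change the argument, so principal powers multiply. -/
theorem ofReal_mul_cpow {a : ℝ} (ha : 0 < a) {z : ℂ} (hz : z ≠ 0) (s : ℂ) :
    ((a : ℂ) * z) ^ s = (a : ℂ) ^ s * z ^ s := by
  have ha' : (a : ℂ) ≠ 0 := by exact_mod_cast ha.ne'
  rw [Complex.cpow_def_of_ne_zero (mul_ne_zero ha' hz), Complex.cpow_def_of_ne_zero ha',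
    Complex.cpow_def_of_ne_zero hz, Complex.log_ofReal_mul ha hz, Complex.ofReal_log ha.le,
    add_mul, Complex.exp_add]

/-- Completing the square in `σ`: the exponent is `-2σ² + i(rl-4)σ + 2 - rl`, whose Gaussian
integral leaves exactly `-r²l²/8`. -/
theorem subordConst_mul_integral (r l : ℝ) :
    subordConst * ∫ σ : ℝ, Complex.exp (-2 * (σ + Complex.I) ^ 2 - r * complexTime σ * l) =
      Complex.exp (-(r ^ 2 * l ^ 2 / 8)) := by
  have h := integral_cexp_quadratic (b := -2) (by simp) (Complex.I * (r * l - 4)) (2 - r * l)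
  have h1 : ∀ σ : ℝ, Complex.exp (-2 * (σ + Complex.I) ^ 2 - r * complexTime σ * l) =
      Complex.exp (-2 * (σ : ℂ) ^ 2 + Complex.I * (r * l - 4) * σ + (2 - r * l)) := by
    intro σ
    congr 1
    rw [complexTime]
    linear_combination (-2 : ℂ) * Complex.I_sq
  have h2 : (2 - r * l : ℂ) - (Complex.I * (r * l - 4)) ^ 2 / (4 * -2) =
      -(r ^ 2 * l ^ 2 / 8) := by
    rw [mul_pow, Complex.I_sq]; ring
  simp only [h1]
  rw [h, h2, neg_neg, subordConst, inv_mul_cancel_left₀]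
  rw [Ne, Complex.cpow_eq_zero_iff]
  have := Real.pi_ne_zero
  simp [this]

theorem norm_exp_subord (r l : ℝ) (σ θ : ℝ) :
    ‖Complex.exp (-2 * (σ + Complex.I) ^ 2 - r * complexTime σ * l + Complex.I * θ)‖ =
      Real.exp (2 - 2 * σ ^ 2) * Real.exp (-(r * l)) := by
  rw [Complex.norm_exp, ← Real.exp_add]
  congr 1
  simp [pow_two, complexTime]
  ring

theorem integrable_exp_neg_mul_normSq {r : ℝ} (hr : 0 < r) :
    Integrable fun ξ : E => Real.exp (-(r * ‖ξ‖ ^ 2)) := by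
  by_contra h
  have h1 := GaussianFourier.integral_rexp_neg_mul_sq_norm (V := E) hr
  simp only [neg_mul] at h1
  rw [integral_undef h] at h1
  have := Real.pi_pos
  have : 0 < (Real.pi / r) ^ (Module.finrank ℝ E / 2 : ℝ) := by positivity
  linarith

/-- Here the shift by `i` matters: it gives the complex time real part `1`, hence the factor
`e^{-r‖ξ‖²}` that makes the double integral absolutely convergent. -/
theorem integrable_subord_prod {r : ℝ} (hr : 0 < r) (x : E) :
    Integrable (fun q : E × ℝ => Complex.exp (-2 * (q.2 + Complex.I) ^ 2
      - r * complexTime q.2 * ((-2 + ‖q.1‖ ^ 2 : ℝ) : ℂ) + Complex.I * (inner ℝ q.1 x : ℝ)))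
      ((volume : Measure E).prod volume) := by
  have h1 : Integrable fun σ : ℝ => Real.exp (2 - 2 * σ ^ 2) := by
    have := (integrable_exp_neg_mul_sq (b := 2) two_pos).const_mul (Real.exp 2)
    refine this.congr (Eventually.of_forall fun σ => ?_)
    simp only [← Real.exp_add]
    congr 1; ring
  have h2 := ((integrable_exp_neg_mul_normSq (d := d) hr).const_mul (Real.exp (2 * r))).mul_prod h1
  refine Integrable.mono' h2 ?_ (Eventually.of_forall fun q => ?_)
  · have := continuous_complexTime
    exact Continuous.aestronglyMeasurable (by fun_prop)
  · rw [norm_exp_subord]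
    refine le_of_eq ?_
    rw [mul_comm]
    congr 1
    rw [← Real.exp_add]
    congr 1; ring

theorem cpow_rescale {r : ℝ} (hr : 0 < r) (σ : ℝ) :
    (Real.pi / (r * complexTime σ) : ℂ) ^ (d / 2 : ℂ) =
      (((Real.sqrt r) ^ d)⁻¹ : ℝ) * (Real.pi / complexTime σ) ^ (d / 2 : ℂ) := by
  have hw := complexTime_ne_zero σ
  have hpi : (Real.pi : ℂ) ≠ 0 := by exact_mod_cast Real.pi_ne_zero
  have h1 : (Real.pi / (r * complexTime σ) : ℂ) = ((r⁻¹ : ℝ) : ℂ) * (Real.pi / complexTime σ) := by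
    push_cast
    rw [div_mul_eq_div_div, div_eq_inv_mul, div_eq_inv_mul, div_eq_inv_mul]
    ring
  have h2 : (((r⁻¹ : ℝ) : ℂ)) ^ (d / 2 : ℂ) = (((Real.sqrt r) ^ d)⁻¹ : ℝ) := by
    rw [show (d / 2 : ℂ) = ((d / 2 : ℝ) : ℂ) by push_cast; rfl,
      ← Complex.ofReal_cpow (by positivity), Real.inv_rpow hr.le, Real.sqrt_eq_rpow,
      ← Real.rpow_natCast, ← Real.rpow_mul hr.le]
    congr 4
    ring
  rw [h1, ofReal_mul_cpow (by positivity) (div_ne_zero hpi hw), h2]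

/-- The Fourier transform of a Gaussian with complex parameter `r(1-iσ)`. The constant `-2` in the
symbol contributes `e^{2r(1-iσ)}`, whose modulus goes into the prefactor and whose phase goes into
`amplitude`. -/
theorem integral_subord_space {r : ℝ} (hr : 0 < r) (x : E) (σ : ℝ) :
    ∫ ξ : E, Complex.exp (-2 * (σ + Complex.I) ^ 2
      - r * complexTime σ * ((-2 + ‖ξ‖ ^ 2 : ℝ) : ℂ) + Complex.I * (inner ℝ ξ x : ℝ)) =
    (Real.exp (2 * r) * ((Real.sqrt r) ^ d)⁻¹ : ℝ) *
      gaussianProfile d r ((Real.sqrt r)⁻¹ • x) σ := by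
  have hw := complexTime_ne_zero σ
  have hr' : (r : ℂ) ≠ 0 := by exact_mod_cast hr.ne'
  have h := GaussianFourier.integral_cexp_neg_mul_sq_norm_add (V := E)
    (b := r * complexTime σ) (by rw [Complex.re_ofReal_mul, complexTime_re]; simpa using hr)
    Complex.I x
  have h1 : ∀ ξ : E, Complex.exp (-2 * (σ + Complex.I) ^ 2
      - r * complexTime σ * ((-2 + ‖ξ‖ ^ 2 : ℝ) : ℂ) + Complex.I * (inner ℝ ξ x : ℝ)) =
      Complex.exp (-2 * (σ + Complex.I) ^ 2 + 2 * r * complexTime σ) *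
      Complex.exp (-(r * complexTime σ) * ‖ξ‖ ^ 2 + Complex.I * (inner ℝ x ξ : ℝ)) := by
    intro ξ
    rw [← Complex.exp_add, real_inner_comm]
    congr 1
    push_cast
    ring
  simp only [h1]
  rw [integral_const_mul, h, finrank_euclideanSpace, Fintype.card_fin, cpow_rescale hr,
    gaussianProfile, amplitude]
  have h2 : Complex.exp (-2 * (σ + Complex.I) ^ 2 + 2 * r * complexTime σ) =
      (Real.exp (2 * r) : ℝ) *
        Complex.exp (-2 * (σ + Complex.I) ^ 2 - 2 * r * σ * Complex.I) := by
    rw [Complex.ofReal_exp, ← Complex.exp_add]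
    congr 1
    rw [complexTime]
    push_cast
    ring
  have h3 : Complex.I ^ 2 * (‖x‖ : ℂ) ^ 2 / (4 * (r * complexTime σ)) =
      -((‖(Real.sqrt r)⁻¹ • x‖ : ℝ) : ℂ) ^ 2 / (4 * complexTime σ) := by
    have hs : ((Real.sqrt r : ℝ) : ℂ) ^ 2 = r := by
      rw [← Complex.ofReal_pow, Real.sq_sqrt hr.le]
    rw [norm_smul, Real.norm_of_nonneg (by positivity), Complex.ofReal_mul, Complex.ofReal_inv,
      mul_pow, inv_pow, hs, Complex.I_sq]
    field_simp
  rw [h2, h3]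
  push_cast
  ring

/-- The scaling form of the kernel: with `r = √t`,
`K_{t;x,y} = r^{-d/2} κ(r, (x - y)/√r)`. -/
theorem kernel_eq_profile {t : ℝ} (ht : 0 < t) (x y : E) :
    kernel d t x y = ((Real.sqrt (Real.sqrt t)) ^ d)⁻¹ *
      profile d (fun _ _ => 1) (Real.sqrt t) ((Real.sqrt (Real.sqrt t))⁻¹ • (x - y)) := by
  set r := Real.sqrt t with hrdef
  have hr : 0 < r := Real.sqrt_pos.2 ht
  have hrt : r ^ 2 = t := Real.sq_sqrt ht.le
  have hint := integrable_subord_prod hr (x - y)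
  have hpt : ∀ ξ : E, Real.exp (-(t / 8) * (-2 + ‖ξ‖ ^ 2) ^ 2) * Real.cos (inner ℝ ξ (x - y)) =
      (subordConst * ∫ σ : ℝ, Complex.exp (-2 * (σ + Complex.I) ^ 2
      - r * complexTime σ * ((-2 + ‖ξ‖ ^ 2 : ℝ) : ℂ)
      + Complex.I * (inner ℝ ξ (x - y) : ℝ))).re := by
    intro ξ
    simp only [Complex.exp_add _ (Complex.I * _)]
    rw [integral_mul_const, ← mul_assoc, subordConst_mul_integral, mul_comm Complex.I,
      Complex.exp_mul_I, ← Complex.ofReal_cos, ← Complex.ofReal_sin]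
    have : Complex.exp (-((r : ℂ) ^ 2 * ((-2 + ‖ξ‖ ^ 2 : ℝ) : ℂ) ^ 2 / 8)) =
        (Real.exp (-(t / 8) * (-2 + ‖ξ‖ ^ 2) ^ 2) : ℝ) := by
      rw [Complex.ofReal_exp, ← hrt]
      congr 1
      push_cast
      ring
    rw [this, Complex.re_ofReal_mul]
    simp [Complex.cos_ofReal_re]
  have hre := integral_re (𝕜 := ℂ) (hint.integral_prod_left.const_mul subordConst)
  simp only [RCLike.re_eq_complex_re] at hre
  rw [kernel, profile]
  simp only [hpt]
  -- Fubini: integrating in `ξ` first leaves the superposition of Gaussians in `σ`.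
  rw [hre, integral_const_mul, integral_integral_swap hint]
  simp only [integral_subord_space hr, mul_one]
  rw [integral_const_mul, mul_left_comm, Complex.re_ofReal_mul]
  ring

/-- The two bases multiply to `(2π)²`; the principal powers combine because `complexTime σ` has
positive real part. -/
theorem cpow_mul_cpow_gaussian (σ : ℝ) :
    (Real.pi / complexTime σ : ℂ) ^ (d / 2 : ℂ) *
      (Real.pi / (4 * complexTime σ)⁻¹ : ℂ) ^ (d / 2 : ℂ) = ((2 * Real.pi) ^ d : ℝ) := by
  have hw := complexTime_ne_zero σ
  have hpi := Real.pi_pos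
  have harg : (complexTime σ).arg ≠ Real.pi := by
    intro h
    have := (Complex.arg_eq_pi_iff.1 h).1
    rw [complexTime_re] at this
    linarith
  have h1 : (Real.pi / (4 * complexTime σ)⁻¹ : ℂ) = ((4 * Real.pi : ℝ) : ℂ) * complexTime σ := by
    rw [div_inv_eq_mul]; push_cast; ring
  rw [h1, div_eq_mul_inv, ofReal_mul_cpow hpi (inv_ne_zero hw), ofReal_mul_cpow (by positivity) hw,
    Complex.inv_cpow _ _ harg]
  have hw' : complexTime σ ^ (d / 2 : ℂ) ≠ 0 := by
    rw [Ne, Complex.cpow_eq_zero_iff]; simp [hw]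
  have h2 : (Real.pi : ℂ) ^ (d / 2 : ℂ) * ((4 * Real.pi : ℝ) : ℂ) ^ (d / 2 : ℂ) =
      ((2 * Real.pi) ^ d : ℝ) := by
    rw [← Complex.mul_cpow_ofReal_nonneg hpi.le (by positivity), ← Complex.ofReal_mul,
      show (d / 2 : ℂ) = ((d / 2 : ℝ) : ℂ) by push_cast; rfl,
      ← Complex.ofReal_cpow (by positivity),
      show Real.pi * (4 * Real.pi) = (2 * Real.pi) ^ (2 : ℝ) by rw [Real.rpow_two]; ring,
      ← Real.rpow_mul (by positivity), mul_div_cancel₀ _ (by norm_num : (2 : ℝ) ≠ 0),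
      Real.rpow_natCast]
  rw [← h2]
  field_simp

/-- Integrating the Gaussians in `z` leaves the subordination integral at `l = 0`, which is one.
Unit mass at `r = 0` makes the linear flow start at `u₀`. -/
theorem integral_profile_zero : ∫ z : E, profile d (fun _ _ => 1) 0 z = 1 := by
  obtain ⟨C, hC, hbd⟩ := exists_gaussianProfile_mul_bound d
  have hint : Integrable (fun q : E × ℝ => gaussianProfile d 0 q.1 q.2 * 1)
      ((volume : Measure E).prod volume) := by
    refine Integrable.mono' ((integrable_decay.const_mul C).mul_prod integrable_exp_neg_sq) ?_
      (Eventually.of_forall fun q => hbd _ isMultiplier_one 0 q.1 q.2)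
    have hc : Continuous fun q : E × ℝ => (((0 : ℝ), q.1), q.2) := by fun_prop
    exact ((continuous_gaussianProfile.comp hc).mul continuous_const).aestronglyMeasurable
  have hre := integral_re (𝕜 := ℂ) (hint.integral_prod_left.const_mul subordConst)
  simp only [RCLike.re_eq_complex_re] at hre
  simp only [profile]
  rw [integral_const_mul, hre, integral_const_mul, integral_integral_swap hint]
  have hsp : ∀ σ : ℝ, ∫ z : E, gaussianProfile d 0 z σ * 1 =
      Complex.exp (-2 * (σ + Complex.I) ^ 2 - (0 : ℝ) * complexTime σ * (0 : ℝ)) *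
        ((2 * Real.pi) ^ d : ℝ) := by
    intro σ
    have hw := complexTime_ne_zero σ
    have hb : 0 < ((4 * complexTime σ)⁻¹).re := by
      rw [Complex.inv_re]
      have h4 : (4 * complexTime σ).re = 4 := by simp [complexTime_re]
      have h5 : 0 < Complex.normSq (4 * complexTime σ) :=
        Complex.normSq_pos.2 (mul_ne_zero (by norm_num) hw)
      rw [h4]
      positivity
    have h := GaussianFourier.integral_cexp_neg_mul_sq_norm (V := E) hb
    rw [finrank_euclideanSpace, Fintype.card_fin] at h
    have h1 : ∀ z : E, gaussianProfile d 0 z σ * 1 = amplitude d 0 σ *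
        Complex.exp (-(4 * complexTime σ)⁻¹ * ‖z‖ ^ 2) := by
      intro z
      rw [mul_one, gaussianProfile]
      congr 2
      rw [div_eq_mul_inv]; ring
    simp only [h1]
    rw [integral_const_mul, h, amplitude, mul_assoc, cpow_mul_cpow_gaussian]
    simp
  simp only [hsp]
  rw [integral_mul_const, ← mul_assoc, subordConst_mul_integral]
  have := Real.pi_pos
  simp only [Complex.ofReal_zero, mul_zero, Real.exp_zero, one_mul]
  norm_num
  rw [← Complex.ofReal_ofNat 2, ← Complex.ofReal_mul, ← Complex.ofReal_pow, Complex.ofReal_re,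
    inv_mul_cancel₀ (by positivity)]

/-- Differentiation under the integral in `σ`: each Gaussian acquires the factor `-z_ℓ / (2(1-iσ))`,
and the bound for multipliers of linear growth dominates the derivative uniformly in `z`. -/
theorem hasLineDerivAt_profile (ℓ : Fin d) (r : ℝ) (z : E) :
    HasLineDerivAt ℝ (profile d (fun _ _ => 1) r) (-profile d (gradMultiplier ℓ) r z) z
      (EuclideanSpace.single ℓ (1 : ℝ)) := by
  obtain ⟨C, hC, hbd⟩ := exists_gaussianProfile_mul_bound d
  set e : E := EuclideanSpace.single ℓ (1 : ℝ) with he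
  have hpt : ∀ (σ s : ℝ), HasDerivAt (fun s : ℝ => gaussianProfile d r (z + s • e) σ * 1)
      (-(gaussianProfile d r (z + s • e) σ * gradMultiplier ℓ (z + s • e) σ)) s := by
    intro σ s
    have hw := complexTime_ne_zero σ
    have h1 : HasDerivAt (fun s : ℝ => z + s • e) e s := by
      simpa using ((hasDerivAt_id s).smul_const e).const_add z
    have h2 := h1.norm_sq.ofReal_comp
    have h3 : inner ℝ (z + s • e) e = (z + s • e) ℓ := by
      rw [he, EuclideanSpace.inner_single_right]; simp
    rw [h3] at h2
    have h4 := (((h2.neg.div_const (4 * complexTime σ)).cexp).const_mul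
      (amplitude d r σ)).mul_const 1
    refine (h4.congr_deriv ?_).congr_of_eventuallyEq (Eventually.of_forall fun s => ?_)
    · simp only [gaussianProfile, gradMultiplier, Pi.neg_apply]
      push_cast
      field_simp
      ring
    · simp only [gaussianProfile, Pi.neg_apply]
      push_cast
      rfl
  have hmain := (hasDerivAt_integral_of_dominated_loc_of_deriv_le (μ := volume) (s := univ)
    (x₀ := (0 : ℝ)) (bound := fun σ => C * Real.exp (-σ ^ 2))
    (F := fun s σ => gaussianProfile d r (z + s • e) σ * 1)
    (F' := fun s σ => -(gaussianProfile d r (z + s • e) σ * gradMultiplier ℓ (z + s • e) σ))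
    univ_mem
    (Eventually.of_forall fun s =>
      (isMultiplier_one.integrable_integrand r (z + s • e)).aestronglyMeasurable)
    (isMultiplier_one.integrable_integrand r _)
    ((isMultiplier_gradMultiplier ℓ).integrable_integrand r _).aestronglyMeasurable.neg
    (Eventually.of_forall fun σ s _ => by
      rw [norm_neg]
      refine (hbd _ (isMultiplier_gradMultiplier ℓ) r _ σ).trans ?_
      gcongr
      exact mul_le_of_le_one_right hC (decay_le_one _))
    (integrable_exp_neg_sq.const_mul C)
    (Eventually.of_forall fun σ s _ => hpt σ s)).2
  have hre := (Complex.reCLM.hasFDerivAt.comp_hasDerivAt (0 : ℝ)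
    (hmain.const_mul subordConst)).const_mul (Real.exp (2 * r) * ((2 * Real.pi) ^ d)⁻¹)
  refine (hre.congr_deriv ?_)
  simp only [profile, zero_smul, add_zero, integral_neg, Complex.reCLM_apply, mul_neg,
    Complex.neg_re]

end KernelFormula

/-! ### Scaling and operator bounds for the gradient kernel -/

section GradKernel

variable {d : ℕ} {p : ℝ}

local notation "E" => EuclideanSpace ℝ (Fin d)

/-- The parabolic length scale `t^{1/4}`. -/
def scale (t : ℝ) : ℝ := Real.sqrt (Real.sqrt t)

theorem scale_pos {t : ℝ} (ht : 0 < t) : 0 < scale t :=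
  Real.sqrt_pos.2 (Real.sqrt_pos.2 ht)

theorem scale_mono {s t : ℝ} (h : s ≤ t) : scale s ≤ scale t :=
  Real.sqrt_le_sqrt (Real.sqrt_le_sqrt h)

theorem continuous_scale : Continuous scale := by unfold scale; fun_prop

theorem scale_eq_rpow {t : ℝ} (ht : 0 ≤ t) : scale t = t ^ (1 / 4 : ℝ) := by
  rw [scale, Real.sqrt_eq_rpow, Real.sqrt_eq_rpow, ← Real.rpow_mul ht]
  norm_num

/-- The convolution kernel of `∂K_{t;x,y}/∂y_ℓ`. -/
def gradKernel (ℓ : Fin d) (t : ℝ) (x : E) : ℝ :=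
  (scale t ^ (d + 1))⁻¹ * profile d (gradMultiplier ℓ) (Real.sqrt t) ((scale t)⁻¹ • x)

/-- The minus sign from differentiating `x - y` in `y` cancels the one in `hasLineDerivAt_profile`;
the chain rule contributes the additional `ρ⁻¹`. -/
theorem kernelDeriv_eq_gradKernel (ℓ : Fin d) {t : ℝ} (ht : 0 < t) (x y : E) :
    kernelDeriv d ℓ t x y = gradKernel ℓ t (x - y) := by
  set e : E := EuclideanSpace.single ℓ (1 : ℝ) with he
  have hρ := scale_pos ht
  set ρ := scale t with hρdef
  -- The base point `-ρ⁻¹ * 0` is the value at `0` of the inner function `s ↦ -ρ⁻¹ * s`, as the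
  -- chain rule requires.
  have hline : HasDerivAt (fun u : ℝ => profile d (fun _ _ => 1) (Real.sqrt t)
      (ρ⁻¹ • (x - y) + u • e))
      (-profile d (gradMultiplier ℓ) (Real.sqrt t) (ρ⁻¹ • (x - y))) (-ρ⁻¹ * 0) := by
    rw [mul_zero]
    exact hasLineDerivAt_profile ℓ (Real.sqrt t) (ρ⁻¹ • (x - y))
  have hin : HasDerivAt (fun s : ℝ => -ρ⁻¹ * s) (-ρ⁻¹) 0 := by
    simpa using (hasDerivAt_id (0 : ℝ)).const_mul (-ρ⁻¹)
  have hcomp := (hline.comp (0 : ℝ) hin).const_mul (ρ ^ d)⁻¹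
  have hfin : HasLineDerivAt ℝ (fun z => kernel d t x z) (gradKernel ℓ t (x - y)) y e := by
    refine (hcomp.congr_deriv ?_).congr_of_eventuallyEq (Eventually.of_forall fun s => ?_)
    · rw [gradKernel, ← hρdef]
      field_simp
      ring
    · simp only [Function.comp]
      rw [kernel_eq_profile ht]
      congr 2
      change ρ⁻¹ • (x - (y + s • e)) = _
      module
  exact hfin.lineDeriv

theorem continuous_gradKernel (ℓ : Fin d) (t : ℝ) : Continuous (gradKernel ℓ t) := by
  unfold gradKernel
  have hc : Continuous fun x : E => (Real.sqrt t, (scale t)⁻¹ • x) := by fun_prop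
  exact continuous_const.mul ((isMultiplier_gradMultiplier ℓ).continuous_profile.comp hc)

theorem continuousAt_gradKernel (ℓ : Fin d) (x : E) {t : ℝ} (ht : 0 < t) :
    ContinuousAt (fun t => gradKernel ℓ t x) t := by
  unfold gradKernel
  have hρ := (scale_pos ht).ne'
  have hs : ContinuousAt scale t := continuous_scale.continuousAt
  have hc : ContinuousAt (fun t : ℝ => (Real.sqrt t, (scale t)⁻¹ • x)) t :=
    (Real.continuous_sqrt.continuousAt).prodMk ((hs.inv₀ hρ).smul continuousAt_const)
  exact ((hs.pow _).inv₀ (pow_ne_zero _ hρ)).mul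
    (((isMultiplier_gradMultiplier ℓ).continuous_profile.continuousAt).comp hc)

theorem isConvKernel_decay (c ρ : ℝ) (hρ : 0 < ρ) : IsConvKernel fun x : E => c * decay (ρ⁻¹ • x) where
  continuous := continuous_const.mul (continuous_decay.comp (by fun_prop))
  integrable := (integrable_decay.comp_smul (inv_ne_zero hρ.ne')).const_mul c
  bounded := ⟨|c|, fun x => by
    rw [abs_mul, abs_of_pos (decay_pos _)]
    exact mul_le_of_le_one_right (abs_nonneg _) (decay_le_one _)⟩

theorem IsConvKernel.mono {g h : E → ℝ} (hg : IsConvKernel g) (hc : Continuous h)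
    (hle : ∀ x, |h x| ≤ g x) : IsConvKernel h where
  continuous := hc
  integrable := hg.integrable.mono' hc.aestronglyMeasurable (Eventually.of_forall hle)
  bounded := by
    obtain ⟨M, hM⟩ := hg.bounded
    exact ⟨M, fun x => (hle x).trans ((le_abs_self _).trans (hM x))⟩

theorem exists_gradKernel_bound (d : ℕ) : ∃ C : ℝ, 0 ≤ C ∧
    ∀ (ℓ : Fin d) (t : ℝ) (x : EuclideanSpace ℝ (Fin d)), 0 < t → |gradKernel ℓ t x| ≤
      (scale t ^ (d + 1))⁻¹ * (C * Real.exp (2 * Real.sqrt t)) * decay ((scale t)⁻¹ • x) := by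
  obtain ⟨C, hC, h⟩ := exists_profile_bound d
  refine ⟨C, hC, fun ℓ t x ht => ?_⟩
  have hρ := scale_pos ht
  rw [gradKernel, abs_mul, abs_of_pos (by positivity), mul_assoc]
  gcongr
  exact h _ (isMultiplier_gradMultiplier ℓ) _ _

theorem isConvKernel_gradKernel (ℓ : Fin d) {t : ℝ} (ht : 0 < t) :
    IsConvKernel (gradKernel ℓ t) := by
  obtain ⟨C, -, h⟩ := exists_gradKernel_bound d
  exact (isConvKernel_decay _ _ (scale_pos ht)).mono (continuous_gradKernel ℓ t)
    fun x => h ℓ t x ht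

/-- Locally in time, the gradient kernels are dominated by a single convolution kernel. -/
theorem exists_local_dominating_kernel (ℓ : Fin d) {t₀ : ℝ} (ht₀ : 0 < t₀) :
    ∃ g : E → ℝ, IsConvKernel g ∧ ∀ᶠ t in 𝓝 t₀, 0 < t ∧ ∀ x, |gradKernel ℓ t x| ≤ g x := by
  obtain ⟨C, hC, h⟩ := exists_gradKernel_bound d
  -- Each factor is taken at its worst time in `[t₀/2, 2t₀]`: the earliest for the inverse power,
  -- the latest for the exponential and the spatial decay.
  refine ⟨fun x => ((scale (t₀ / 2) ^ (d + 1))⁻¹ * (C * Real.exp (2 * Real.sqrt (2 * t₀)))) *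
    decay ((scale (2 * t₀))⁻¹ • x), isConvKernel_decay _ _ (scale_pos (by positivity)), ?_⟩
  filter_upwards [Icc_mem_nhds (show t₀ / 2 < t₀ by linarith) (show t₀ < 2 * t₀ by linarith)]
    with t ht
  have ht0 : 0 < t := by linarith [ht.1]
  refine ⟨ht0, fun x => (h ℓ t x ht0).trans ?_⟩
  have h1 := scale_mono ht.1
  have h2 := scale_mono ht.2
  have h3 : 0 < scale (t₀ / 2) := scale_pos (by positivity)
  have h4 := scale_pos ht0
  have h5 : Real.sqrt t ≤ Real.sqrt (2 * t₀) := Real.sqrt_le_sqrt ht.2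
  have h6 : decay ((scale t)⁻¹ • x) ≤ decay ((scale (2 * t₀))⁻¹ • x) := by
    refine decay_anti ?_
    rw [norm_smul, norm_smul, Real.norm_of_nonneg (inv_nonneg.2 (h4.le.trans h2)),
      Real.norm_of_nonneg (inv_nonneg.2 h4.le)]
    gcongr
  have h7 := (decay_pos ((scale t)⁻¹ • x)).le
  gcongr

/-- For the difference of two kernels the `L¹` norm tends to zero by dominated convergence while the
sup norm stays below `2M`; since `2p - 1 > 0`, the Young bound tends to zero. -/
theorem continuousOn_convL_gradKernel [hp : Fact (1 ≤ p)] (ℓ : Fin d) :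
    ContinuousOn (fun t => convL p (gradKernel ℓ t)) (Ioi 0) := by
  intro t₀ ht₀
  refine ContinuousAt.continuousWithinAt ?_
  have ht₀' : 0 < t₀ := ht₀
  have hp1 := hp.out
  obtain ⟨g, hg, hdom⟩ := exists_local_dominating_kernel ℓ ht₀'
  obtain ⟨M, hM⟩ := hg.bounded
  have hM' : ∀ x, g x ≤ M := fun x => (le_abs_self _).trans (hM x)
  have hA : Tendsto (fun t => ∫ x, |gradKernel ℓ t x - gradKernel ℓ t₀ x|) (𝓝 t₀) (𝓝 0) := by
    have := tendsto_integral_filter_of_dominated_convergence (μ := (volume : Measure E))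
      (F := fun t x => |gradKernel ℓ t x - gradKernel ℓ t₀ x|) (f := fun _ => 0) (l := 𝓝 t₀)
      (fun x => 2 * g x)
      (Eventually.of_forall fun t =>
        ((continuous_gradKernel ℓ t).sub (continuous_gradKernel ℓ t₀)).abs.aestronglyMeasurable)
      (by
        filter_upwards [hdom] with t ht
        refine Eventually.of_forall fun x => ?_
        rw [Real.norm_eq_abs, abs_abs]
        refine (abs_sub _ _).trans ?_
        linarith [ht.2 x, hdom.self_of_nhds.2 x])
      (hg.integrable.const_mul 2)
      (Eventually.of_forall fun x => by
        have := (((continuousAt_gradKernel ℓ x ht₀').sub continuousAt_const).abs :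
          ContinuousAt (fun t => |gradKernel ℓ t x - gradKernel ℓ t₀ x|) t₀)
        simpa [ContinuousAt] using this)
    simpa using this
  have hlim : Tendsto (fun t => ((∫ x, |gradKernel ℓ t x - gradKernel ℓ t₀ x|) ^ (2 * p - 1) *
      (2 * M)) ^ (1 / (2 * p))) (𝓝 t₀) (𝓝 0) := by
    have h1 := ((hA.rpow_const (p := 2 * p - 1) (Or.inr (by linarith))).mul_const
      (2 * M)).rpow_const (p := 1 / (2 * p)) (Or.inr (by positivity))
    rwa [Real.zero_rpow (by linarith), zero_mul, Real.zero_rpow (by positivity)] at h1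
  rw [ContinuousAt, tendsto_iff_norm_sub_tendsto_zero]
  refine squeeze_zero' (Eventually.of_forall fun t => norm_nonneg _) ?_ hlim
  filter_upwards [hdom] with t ht
  have h1 := isConvKernel_gradKernel ℓ ht.1
  have h2 := isConvKernel_gradKernel ℓ ht₀'
  rw [convL_sub h1 h2]
  refine (h1.sub h2).norm_convL_le le_rfl fun x => (abs_sub _ _).trans ?_
  linarith [ht.2 x, hdom.self_of_nhds.2 x, hM' x]

/-- Inserting `‖h‖₁ ≤ Lρ⁻¹` and `‖h‖_∞ ≤ Lρ^{-(d+1)}` in the Young bound gives `Lρ^{-(1 + d/(2p))}`,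
where `ρ = t^{1/4}`. -/
theorem exists_norm_convL_gradKernel_le [hp : Fact (1 ≤ p)] (d : ℕ) (T : ℝ) :
    ∃ C : ℝ, 0 ≤ C ∧ ∀ (ℓ : Fin d), ∀ t ∈ Ioc 0 T,
      ‖convL p (gradKernel ℓ t)‖ ≤ C * t ^ (-(1 / 4 + d / (8 * p))) := by
  obtain ⟨C, hC, h⟩ := exists_gradKernel_bound d
  have hp1 := hp.out
  set D : ℝ := ∫ x : EuclideanSpace ℝ (Fin d), decay x with hD
  have hD0 : 0 ≤ D := integral_nonneg fun x => (decay_pos x).le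
  -- `D + 1` dominates both `D`, needed for the `L¹` norm, and `1`, needed for the sup norm.
  set L : ℝ := C * Real.exp (2 * Real.sqrt T) * (D + 1) with hL
  have hL0 : 0 ≤ L := by positivity
  refine ⟨L, hL0, fun ℓ t ht => ?_⟩
  have hρ := scale_pos ht.1
  set ρ := scale t with hρdef
  have hexp : C * Real.exp (2 * Real.sqrt t) ≤ C * Real.exp (2 * Real.sqrt T) := by
    have := Real.sqrt_le_sqrt ht.2
    gcongr
  have hA : ∫ y, |gradKernel ℓ t y| ≤ L * ρ⁻¹ := by
    have h1 : ∫ y, |gradKernel ℓ t y| ≤ ∫ y : EuclideanSpace ℝ (Fin d),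
        (ρ ^ (d + 1))⁻¹ * (C * Real.exp (2 * Real.sqrt t)) * decay (ρ⁻¹ • y) :=
      integral_mono_of_nonneg (Eventually.of_forall fun _ => abs_nonneg _)
        (isConvKernel_decay _ _ hρ).integrable (Eventually.of_forall fun y => h ℓ t y ht.1)
    refine h1.trans ?_
    rw [integral_const_mul, Measure.integral_comp_inv_smul, finrank_euclideanSpace,
      Fintype.card_fin, abs_of_pos (by positivity), smul_eq_mul, ← hD]
    calc (ρ ^ (d + 1))⁻¹ * (C * Real.exp (2 * Real.sqrt t)) * (ρ ^ d * D)
        = C * Real.exp (2 * Real.sqrt t) * D * ρ⁻¹ := by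
          rw [pow_succ]; field_simp
      _ ≤ C * Real.exp (2 * Real.sqrt T) * (D + 1) * ρ⁻¹ := by
          gcongr
          linarith
  have hM : ∀ x, |gradKernel ℓ t x| ≤ L * (ρ ^ (d + 1))⁻¹ := by
    intro x
    refine (h ℓ t x ht.1).trans ?_
    calc (ρ ^ (d + 1))⁻¹ * (C * Real.exp (2 * Real.sqrt t)) * decay (ρ⁻¹ • x)
        ≤ (ρ ^ (d + 1))⁻¹ * (C * Real.exp (2 * Real.sqrt T)) * (D + 1) := by
          have h1 := decay_le_one (ρ⁻¹ • x)
          have h2 := (decay_pos (ρ⁻¹ • x)).le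
          gcongr
          linarith
      _ = L * (ρ ^ (d + 1))⁻¹ := by rw [hL]; ring
  refine ((isConvKernel_gradKernel ℓ ht.1).norm_convL_le hA hM).trans (le_of_eq ?_)
  have hp2 : (2 * p : ℝ) ≠ 0 := by positivity
  have e1 : (ρ ^ (d + 1))⁻¹ = ρ ^ (-(d + 1 : ℝ)) := by
    rw [Real.rpow_neg hρ.le]; norm_cast
  have e2 : (L * ρ⁻¹) ^ (2 * p - 1) * (L * (ρ ^ (d + 1))⁻¹) =
      L ^ (2 * p) * ρ ^ (-(2 * p + d)) := by
    rw [e1, Real.mul_rpow hL0 (by positivity), ← Real.rpow_neg_one ρ, ← Real.rpow_mul hρ.le]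
    calc L ^ (2 * p - 1) * ρ ^ (-1 * (2 * p - 1)) * (L * ρ ^ (-(d + 1 : ℝ)))
        = (L ^ (2 * p - 1) * L ^ (1 : ℝ)) *
          (ρ ^ (-1 * (2 * p - 1)) * ρ ^ (-(d + 1 : ℝ))) := by rw [Real.rpow_one]; ring
      _ = _ := by
        rw [← Real.rpow_add_of_nonneg hL0 (by linarith) zero_le_one, ← Real.rpow_add hρ]
        congr 2 <;> ring
  rw [e2, Real.mul_rpow (by positivity) (by positivity), ← Real.rpow_mul hL0,
    mul_one_div_cancel hp2, Real.rpow_one, ← Real.rpow_mul hρ.le, hρdef, scale_eq_rpow ht.1.le,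
    ← Real.rpow_mul ht.1.le]
  congr 2
  field_simp
  ring

end GradKernel

/-! ### The linear flow and its continuity up to time zero -/

section LinearFlow

variable {d : ℕ} {p : ℝ}

local notation "E" => EuclideanSpace ℝ (Fin d)

/-- The solution of the linear problem, as an `L^{2p}`-valued Bochner integral. -/
def linearFlow [Fact (1 ≤ p)] (u₀ : L2p d p) (t : ℝ) : L2p d p :=
  ∫ z : E, profile d (fun _ _ => 1) (Real.sqrt t) z • translate (-(scale t • z)) u₀

theorem exists_norm_profile_smul_translate_le [Fact (1 ≤ p)] (T : ℝ) : ∃ C : ℝ, ∀ (u₀ : L2p d p) (t : ℝ), t ≤ T →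
    ∀ z : E, ‖profile d (fun _ _ => 1) (Real.sqrt t) z • translate (-(scale t • z)) u₀‖ ≤
      C * ‖u₀‖ * decay z := by
  obtain ⟨C, hC, h⟩ := exists_profile_bound d
  refine ⟨C * Real.exp (2 * Real.sqrt T), fun u₀ t ht z => ?_⟩
  rw [norm_smul, norm_translate, Real.norm_eq_abs, mul_right_comm]
  have h1 := Real.sqrt_le_sqrt ht
  have h2 := decay_pos z
  refine mul_le_mul_of_nonneg_right ((h _ isMultiplier_one _ z).trans ?_) (norm_nonneg _)
  gcongr

theorem continuous_profile_smul_translate [Fact (1 ≤ p)] (u₀ : L2p d p) :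
    Continuous fun q : ℝ × E =>
      profile d (fun _ _ => 1) (Real.sqrt q.1) q.2 • translate (-(scale q.1 • q.2)) u₀ := by
  have hc : Continuous fun q : ℝ × E => (Real.sqrt q.1, q.2) := by fun_prop
  have hs := continuous_scale
  have ht : Continuous fun q : ℝ × E => -(scale q.1 • q.2) := by fun_prop
  exact (isMultiplier_one.continuous_profile.comp hc).smul ((continuous_translate u₀).comp ht)

theorem integrable_profile_smul_translate [Fact (1 ≤ p)] (u₀ : L2p d p) (t : ℝ) :
    Integrable fun z : E =>
      profile d (fun _ _ => 1) (Real.sqrt t) z • translate (-(scale t • z)) u₀ := by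
  obtain ⟨C, h⟩ := exists_norm_profile_smul_translate_le (d := d) (p := p) t
  have hc : Continuous fun z : E => (t, z) := by fun_prop
  exact (integrable_decay.const_mul (C * ‖u₀‖)).mono'
    ((continuous_profile_smul_translate u₀).comp hc).aestronglyMeasurable
    (Eventually.of_forall fun z => h u₀ t le_rfl z)

/-- In the variable `z` the kernel no longer concentrates as `t → 0`: the integrand is continuous in
`t` and dominated by a multiple of `decay`, so `t = 0` needs no special treatment. -/
theorem continuousOn_linearFlow [Fact (1 ≤ p)] (u₀ : L2p d p) (T : ℝ) :
    ContinuousOn (linearFlow u₀) (Icc 0 T) := by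
  obtain ⟨C, h⟩ := exists_norm_profile_smul_translate_le (d := d) (p := p) T
  unfold linearFlow
  refine continuousOn_of_dominated (bound := fun z => C * ‖u₀‖ * decay z)
    (fun t _ => (integrable_profile_smul_translate u₀ t).aestronglyMeasurable)
    (fun t ht => Eventually.of_forall fun z => h u₀ t ht.2 z) (integrable_decay.const_mul _)
    (Eventually.of_forall fun z => ?_)
  have hc : Continuous fun t : ℝ => (t, z) := by fun_prop
  exact ((continuous_profile_smul_translate u₀).comp hc).continuousOn

theorem linearFlow_zero [Fact (1 ≤ p)] (u₀ : L2p d p) : linearFlow u₀ 0 = u₀ := by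
  have hs : scale 0 = 0 := by simp [scale]
  simp only [linearFlow, hs, zero_smul, neg_zero, translate_zero, Real.sqrt_zero]
  rw [integral_smul_const, integral_profile_zero, one_smul]

/-- The substitution `y = x - ρz`; its Jacobian cancels the normalization `ρ^{-d}` of the kernel. -/
theorem coeFn_linearFlow [Fact (1 ≤ p)] (u₀ : L2p d p) {t : ℝ} (ht : 0 < t) :
    ∀ᵐ x : E, Integrable (fun y => kernel d t x y * u₀ y) ∧
      linearFlow u₀ t x = ∫ y, kernel d t x y * u₀ y := by
  have hρ := scale_pos ht
  set ρ := scale t with hρdef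
  have hm : AEStronglyMeasurable (Function.uncurry fun z x : E =>
      profile d (fun _ _ => 1) (Real.sqrt t) z * u₀ (-(ρ • z) + x))
      ((volume : Measure E).prod volume) := by
    have h1 : Continuous fun q : E × E => (Real.sqrt t, q.1) := by fun_prop
    have h2 : Continuous fun q : E × E => -(ρ • q.1) + q.2 := by fun_prop
    exact ((isMultiplier_one.continuous_profile.comp h1).measurable.mul
      ((Lp.stronglyMeasurable u₀).measurable.comp h2.measurable)).aestronglyMeasurable
  have hae : ∀ᵐ z : E, (profile d (fun _ _ => 1) (Real.sqrt t) z •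
      translate (-(ρ • z)) u₀ : L2p d p) =ᵐ[volume]
      fun x => profile d (fun _ _ => 1) (Real.sqrt t) z * u₀ (-(ρ • z) + x) := by
    refine Eventually.of_forall fun z => ?_
    filter_upwards [Lp.coeFn_smul (profile d (fun _ _ => 1) (Real.sqrt t) z)
      (translate (-(ρ • z)) u₀), coeFn_translate (-(ρ • z)) u₀] with x h1 h2
    rw [h1, Pi.smul_apply, h2, smul_eq_mul]
  filter_upwards [coeFn_integral_Lp (integrable_profile_smul_translate u₀ t) hm hae] with x hx
  set g : E → ℝ := fun y => kernel d t x y * u₀ y with hg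
  have hcv : ∀ z : E, profile d (fun _ _ => 1) (Real.sqrt t) z * u₀ (-(ρ • z) + x) =
      ρ ^ d * g (x - ρ • z) := by
    intro z
    simp only [hg]
    rw [kernel_eq_profile ht, sub_sub_cancel]
    change _ = ρ ^ d * ((ρ ^ d)⁻¹ * profile d (fun _ _ => 1) (Real.sqrt t) (ρ⁻¹ • ρ • z) *
      u₀ (x - ρ • z))
    rw [inv_smul_smul₀ hρ.ne', neg_add_eq_sub]
    field_simp
  have hint : Integrable fun z : E => g (x - ρ • z) := by
    have := hx.1.const_mul (ρ ^ d)⁻¹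
    refine this.congr (Eventually.of_forall fun z => ?_)
    simp only [hcv]
    field_simp
  have hint2 : Integrable fun y : E => g (x - y) :=
    (integrable_comp_smul_iff volume (fun y : E => g (x - y)) hρ.ne').1 hint
  refine ⟨(integrable_comp_sub_left g x).1 hint2, ?_⟩
  rw [linearFlow, hx.2]
  simp only [hcv]
  rw [integral_const_mul, Measure.integral_comp_smul volume (fun y : E => g (x - y)) ρ,
    integral_sub_left_eq_self g volume x, finrank_euclideanSpace, Fintype.card_fin,
    abs_of_pos (by positivity), smul_eq_mul, mul_inv_cancel_left₀ (by positivity)]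

end LinearFlow

/-! ### The Duhamel integral evaluated pointwise -/

section DuhamelPointwise

variable {d : ℕ} {p : ℝ} [hp : Fact (1 ≤ p)]

local notation "E" => EuclideanSpace ℝ (Fin d)

/-- The values `f s y` depend on representatives and need not be continuous in `s`, but the
convolution is. Subtracting `f s₀` leaves a term small in `L^p` norm and a term with fixed data, to
which dominated convergence applies. -/
theorem continuousAt_conv_gradKernel (ℓ : Fin d) {t s₀ : ℝ} (hs₀ : s₀ < t) {f : ℝ → Lreal d p}
    (hf : ContinuousAt f s₀) (x : E) :
    ContinuousAt (fun s => ∫ y, gradKernel ℓ (t - s) (x - y) * f s y) s₀ := by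
  obtain ⟨g, hg, hdom⟩ := exists_local_dominating_kernel ℓ (sub_pos.2 hs₀)
  obtain ⟨M, hM⟩ := hg.bounded
  have hts : Tendsto (fun s => t - s) (𝓝 s₀) (𝓝 (t - s₀)) :=
    (continuous_const.sub continuous_id).continuousAt
  have hdom' := hts.eventually hdom
  have hsplit : (fun s => (∫ y, gradKernel ℓ (t - s) (x - y) * (f s - f s₀ : Lreal d p) y) +
      ∫ y, gradKernel ℓ (t - s) (x - y) * f s₀ y) =ᶠ[𝓝 s₀]
      fun s => ∫ y, gradKernel ℓ (t - s) (x - y) * f s y := by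
    filter_upwards [hdom'] with s hs
    have hk := isConvKernel_gradKernel ℓ hs.1
    rw [← integral_add (hk.integrable_conv _ x) (hk.integrable_conv _ x)]
    refine integral_congr_ae ?_
    filter_upwards [Lp.coeFn_sub (f s) (f s₀)] with y hy
    rw [hy, Pi.sub_apply]
    ring
  have h1 : Tendsto (fun s => ∫ y, gradKernel ℓ (t - s) (x - y) * (f s - f s₀ : Lreal d p) y)
      (𝓝 s₀) (𝓝 0) := by
    have hn : Tendsto (fun s => ((∫ y, g y) ^ (p - 1) * M) ^ (1 / p) * ‖f s - f s₀‖)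
        (𝓝 s₀) (𝓝 0) := by
      have := (tendsto_iff_norm_sub_tendsto_zero.1 hf).const_mul
        (((∫ y, g y) ^ (p - 1) * M) ^ (1 / p))
      rwa [mul_zero] at this
    refine squeeze_zero_norm' ?_ hn
    filter_upwards [hdom'] with s hs
    refine (isConvKernel_gradKernel ℓ hs.1).abs_conv_le ?_ ?_ _ x
    · exact integral_mono_of_nonneg (Eventually.of_forall fun _ => abs_nonneg _) hg.integrable
        (Eventually.of_forall hs.2)
    · exact fun y => (hs.2 y).trans ((le_abs_self _).trans (hM y))
  have h2 : Tendsto (fun s => ∫ y, gradKernel ℓ (t - s) (x - y) * f s₀ y) (𝓝 s₀)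
      (𝓝 (∫ y, gradKernel ℓ (t - s₀) (x - y) * f s₀ y)) := by
    refine tendsto_integral_filter_of_dominated_convergence (fun y => ‖g (x - y) * f s₀ y‖) ?_ ?_
      (hg.integrable_conv (f s₀) x).norm (Eventually.of_forall fun y => ?_)
    · filter_upwards [hdom'] with s hs
      exact ((isConvKernel_gradKernel ℓ hs.1).integrable_conv (f s₀) x).aestronglyMeasurable
    · filter_upwards [hdom'] with s hs
      refine Eventually.of_forall fun y => ?_
      rw [norm_mul, norm_mul]
      gcongr
      exact (hs.2 _).trans (le_abs_self _)
    · exact (((continuousAt_gradKernel ℓ (x - y) (sub_pos.2 hs₀)).tendsto.comp hts).mul_const _)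
  have h3 := h1.add h2
  rw [zero_add] at h3
  exact h3.congr' hsplit

/-- A Carathéodory argument: continuity in `s` and measurability in `x` give joint measurability. -/
theorem aestronglyMeasurable_conv_gradKernel (ℓ : Fin d) {t : ℝ} (ht : 0 < t) {f : ℝ → Lreal d p}
    (hf : ContinuousOn f (Ioo 0 t)) :
    AEStronglyMeasurable (Function.uncurry fun (s : ℝ) (x : E) =>
      ∫ y, gradKernel ℓ (t - s) (x - y) * f s y)
      ((volume.restrict (Ioo 0 t)).prod volume) := by
  -- A measurable retraction onto `Ioo 0 t` transfers the result from the subtype to the line.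
  obtain ⟨e, he, hes⟩ := (measurableSet_Ioo (a := (0 : ℝ)) (b := t)).exists_measurable_proj
    (nonempty_Ioo.2 ht)
  have hsm : StronglyMeasurable (Function.uncurry fun (s : Ioo 0 t) (x : E) =>
      ∫ y, gradKernel ℓ (t - s) (x - y) * f s y) := by
    refine stronglyMeasurable_uncurry_of_continuous_of_stronglyMeasurable (fun x => ?_) fun s => ?_
    · refine continuous_iff_continuousAt.2 fun s => ?_
      exact (continuousAt_conv_gradKernel ℓ s.2.2 (hf.continuousAt (Ioo_mem_nhds s.2.1 s.2.2))
        x).comp continuous_subtype_val.continuousAt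
    · exact (isConvKernel_gradKernel ℓ (sub_pos.2 s.2.2)).stronglyMeasurable_conv (f s)
  have hem : Measurable fun q : ℝ × E => (e q.1, q.2) :=
    (he.comp measurable_fst).prodMk measurable_snd
  refine (hsm.comp_measurable hem).aestronglyMeasurable.congr ?_
  have hset : (volume.restrict (Ioo 0 t)).prod (volume : Measure E) =
      ((volume : Measure ℝ).prod volume).restrict (Ioo 0 t ×ˢ univ) := by
    rw [← Measure.prod_restrict, Measure.restrict_univ]
  rw [hset]
  refine (ae_restrict_iff' (measurableSet_Ioo.prod MeasurableSet.univ)).2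
    (Eventually.of_forall fun q hq => ?_)
  have := hes ⟨q.1, hq.1⟩
  simp only [Function.comp, Function.uncurry] at this ⊢
  rw [this]

theorem coeFn_duhamel_gradKernel (ℓ : Fin d) {C α t : ℝ} (ht : 0 < t) (hα : α < 1)
    (hB : ∀ r ∈ Ioc 0 t, ‖convL p (gradKernel ℓ r)‖ ≤ C * r ^ (-α)) {f : ℝ → Lreal d p}
    (hf : ContinuousOn f (Icc 0 t)) :
    ∀ᵐ x : E, IntervalIntegrable (fun s => ∫ y, gradKernel ℓ (t - s) (x - y) * f s y) volume 0 t ∧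
      duhamel (fun r => convL p (gradKernel ℓ r)) f t x =
        ∫ s in (0 : ℝ)..t, ∫ y, gradKernel ℓ (t - s) (x - y) * f s y := by
  have hint := intervalIntegrable_duhamel hα (continuousOn_convL_gradKernel ℓ) hB hf
    (right_mem_Icc.2 ht.le)
  rw [intervalIntegrable_iff_integrableOn_Ioo_of_le ht.le] at hint
  have hae : ∀ᵐ s ∂(volume.restrict (Ioo 0 t)), convL p (gradKernel ℓ (t - s)) (f s) =ᵐ[volume]
      fun x => ∫ y, gradKernel ℓ (t - s) (x - y) * f s y :=
    (ae_restrict_iff' measurableSet_Ioo).2 (Eventually.of_forall fun s hs =>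
      (isConvKernel_gradKernel ℓ (sub_pos.2 hs.2)).coeFn_convL (f s))
  have hm := aestronglyMeasurable_conv_gradKernel ℓ ht (hf.mono Ioo_subset_Icc_self)
  filter_upwards [coeFn_integral_Lp hint hm hae] with x hx
  rw [intervalIntegrable_iff_integrableOn_Ioo_of_le ht.le, duhamel,
    intervalIntegral.integral_of_le ht.le, intervalIntegral.integral_of_le ht.le,
    integral_Ioc_eq_integral_Ioo, integral_Ioc_eq_integral_Ioo]
  exact hx

end DuhamelPointwise

/-! ### Mild solutions as solutions of the Duhamel equation -/

section MildSolution

variable {d : ℕ} {p : ℝ} [hp : Fact (1 ≤ p)]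

local notation "E" => EuclideanSpace ℝ (Fin d)

instance holderTripleTwoMul :
    ENNReal.HolderTriple (ENNReal.ofReal (2 * p)) (ENNReal.ofReal (2 * p)) (ENNReal.ofReal p) where
  inv_add_inv_eq_inv := by
    have hp1 := hp.out
    rw [← ENNReal.ofReal_inv_of_pos (by positivity), ← ENNReal.ofReal_inv_of_pos (by positivity),
      ← ENNReal.ofReal_add (by positivity) (by positivity)]
    congr 1
    field_simp
    norm_num

/-- The pointwise product `L^{2p} × L^{2p} → L^p`. -/
def mulL (d : ℕ) (p : ℝ) [Fact (1 ≤ p)] : L2p d p →L[ℝ] L2p d p →L[ℝ] Lreal d p :=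
  (ContinuousLinearMap.mul ℝ ℝ).holderL volume (ENNReal.ofReal (2 * p)) (ENNReal.ofReal (2 * p))
    (ENNReal.ofReal p)

theorem coeFn_mulL_self (u : L2p d p) : mulL d p u u =ᵐ[volume] fun x => u x ^ 2 := by
  filter_upwards [(ContinuousLinearMap.mul ℝ ℝ).coeFn_holder (r := ENNReal.ofReal p) u u] with x hx
  rw [pow_two]
  exact hx

/-- The operator `½ ∑_ℓ ∂_ℓ K_r ∗ ·` acting from `L^p` to `L^{2p}`. -/
def gradOp (d : ℕ) (p : ℝ) [Fact (1 ≤ p)] (r : ℝ) : Lreal d p →L[ℝ] L2p d p :=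
  (1 / 2 : ℝ) • ∑ ℓ : Fin d, convL p (gradKernel ℓ r)

theorem continuousOn_gradOp : ContinuousOn (gradOp d p) (Ioi 0) := by
  have h : ContinuousOn (fun r => ∑ ℓ : Fin d, convL p (gradKernel ℓ r)) (Ioi 0) :=
    continuousOn_finsetSum _ fun ℓ _ => continuousOn_convL_gradKernel ℓ
  exact h.const_smul (1 / 2 : ℝ)

theorem exists_norm_gradOp_le (d : ℕ) (T : ℝ) :
    ∃ C : ℝ, 0 ≤ C ∧ ∀ r ∈ Ioc 0 T, ‖gradOp d p r‖ ≤ C * r ^ (-(1 / 4 + d / (8 * p))) := by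
  obtain ⟨C, hC, h⟩ := exists_norm_convL_gradKernel_le (p := p) d T
  refine ⟨1 / 2 * (d * C), by positivity, fun r hr => ?_⟩
  rw [gradOp, norm_smul, Real.norm_of_nonneg (by norm_num)]
  have h1 : ‖∑ ℓ : Fin d, convL p (gradKernel ℓ r)‖ ≤ d * (C * r ^ (-(1 / 4 + d / (8 * p)))) := by
    refine (norm_sum_le_of_le _ fun ℓ _ => h ℓ r hr).trans (le_of_eq ?_)
    simp
  calc _ ≤ 1 / 2 * (d * (C * r ^ (-(1 / 4 + d / (8 * p))))) := by gcongr
    _ = _ := by ring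

theorem integral_kernelDeriv_sq_eq (ℓ : Fin d) {r : ℝ} (hr : 0 < r) (u : L2p d p) (x : E) :
    ∫ y, kernelDeriv d ℓ r x y * u y ^ 2 = ∫ y, gradKernel ℓ r (x - y) * mulL d p u u y := by
  refine integral_congr_ae ?_
  filter_upwards [coeFn_mulL_self u] with y hy
  rw [hy, kernelDeriv_eq_gradKernel ℓ hr]

theorem integrable_kernelDeriv_sq (ℓ : Fin d) {r : ℝ} (hr : 0 < r) (u : L2p d p) (x : E) :
    Integrable fun y => kernelDeriv d ℓ r x y * u y ^ 2 := by
  refine ((isConvKernel_gradKernel ℓ hr).integrable_conv (mulL d p u u) x).congr ?_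
  filter_upwards [coeFn_mulL_self u] with y hy
  rw [hy, kernelDeriv_eq_gradKernel ℓ hr]

/-- This is where the condition `d < 6p` is spent: it makes the time singularity integrable. -/
theorem kernel_exponent_lt_one (hdp : (d : ℝ) < 6 * p) : 1 / 4 + (d : ℝ) / (8 * p) < 1 := by
  have hp1 := hp.out
  have : (d : ℝ) / (8 * p) < 3 / 4 := by
    rw [div_lt_iff₀ (by positivity)]
    linarith
  linarith

theorem coeFn_duhamel_gradOp (hdp : (d : ℝ) < 6 * p) {t : ℝ} (ht : 0 < t) {U : ℝ → L2p d p}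
    (hU : ContinuousOn U (Icc 0 t)) :
    ∀ᵐ x : E, (∀ ℓ : Fin d, IntervalIntegrable
        (fun s => ∫ y, kernelDeriv d ℓ (t - s) x y * U s y ^ 2) volume 0 t) ∧
      duhamel (gradOp d p) (fun s => mulL d p (U s) (U s)) t x =
        1 / 2 * ∑ ℓ : Fin d, ∫ s in (0 : ℝ)..t, ∫ y, kernelDeriv d ℓ (t - s) x y * U s y ^ 2 := by
  obtain ⟨C, -, hB⟩ := exists_norm_convL_gradKernel_le (p := p) d t
  have hα := kernel_exponent_lt_one hdp
  have hf : ContinuousOn (fun s => mulL d p (U s) (U s)) (Icc 0 t) := by fun_prop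
  have hpt := fun ℓ : Fin d => coeFn_duhamel_gradKernel ℓ ht hα (hB ℓ) hf
  have hsum : duhamel (gradOp d p) (fun s => mulL d p (U s) (U s)) t =
      (1 / 2 : ℝ) • ∑ ℓ : Fin d,
        duhamel (fun r => convL p (gradKernel ℓ r)) (fun s => mulL d p (U s) (U s)) t := by
    simp only [duhamel, gradOp, smul_apply, sum_apply]
    rw [intervalIntegral.integral_smul, intervalIntegral.integral_finsetSum fun ℓ _ =>
      intervalIntegrable_duhamel hα (continuousOn_convL_gradKernel ℓ) (hB ℓ) hf
        (right_mem_Icc.2 ht.le)]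
  have hcongr : ∀ (ℓ : Fin d) (x : E), ∀ s ∈ Ioo 0 t,
      ∫ y, gradKernel ℓ (t - s) (x - y) * mulL d p (U s) (U s) y =
      ∫ y, kernelDeriv d ℓ (t - s) x y * U s y ^ 2 := fun ℓ x s hs =>
    (integral_kernelDeriv_sq_eq ℓ (sub_pos.2 hs.2) (U s) x).symm
  rw [hsum]
  filter_upwards [ae_all_iff.2 hpt, Lp.coeFn_smul (1 / 2 : ℝ) (∑ ℓ : Fin d,
      duhamel (fun r => convL p (gradKernel ℓ r)) (fun s => mulL d p (U s) (U s)) t),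
    Lp.coeFn_finsetSum Finset.univ fun ℓ : Fin d =>
      duhamel (fun r => convL p (gradKernel ℓ r)) (fun s => mulL d p (U s) (U s)) t]
    with x hx h1 h2
  constructor
  · intro ℓ
    have h3 := (hx ℓ).1
    rw [intervalIntegrable_iff_integrableOn_Ioo_of_le ht.le] at h3 ⊢
    exact h3.congr_fun (hcongr ℓ x) measurableSet_Ioo
  · rw [h1, Pi.smul_apply, h2, Finset.sum_apply, smul_eq_mul]
    congr 1
    refine Finset.sum_congr rfl fun ℓ _ => ?_
    rw [(hx ℓ).2, intervalIntegral.integral_of_le ht.le, intervalIntegral.integral_of_le ht.le,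
      integral_Ioc_eq_integral_Ioo, integral_Ioc_eq_integral_Ioo]
    exact setIntegral_congr_fun measurableSet_Ioo (hcongr ℓ x)

/-- The pointwise mild formulation is equivalent to the Duhamel equation in `L^{2p}`. -/
theorem isMildSolution_iff (hdp : (d : ℝ) < 6 * p) {u₀ : L2p d p} {τ : ℝ} (hτ : 0 < τ)
    {U : ℝ → L2p d p} :
    IsMildSolution u₀ τ U ↔ ContinuousOn U (Icc 0 τ) ∧ ∀ t ∈ Icc 0 τ,
      U t = linearFlow u₀ t + duhamel (gradOp d p) (fun s => mulL d p (U s) (U s)) t := by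
  constructor
  · intro h
    refine ⟨h.continuousOn, fun t ht => ?_⟩
    -- The kernel formula is available only for `t > 0`; at `t = 0` the equation is the initial
    -- condition.
    rcases ht.1.eq_or_lt with rfl | ht0
    · rw [linearFlow_zero, h.initial, duhamel, intervalIntegral.integral_same, add_zero]
    refine Lp.ext ?_
    filter_upwards [h.mild t ⟨ht0, ht.2⟩, coeFn_linearFlow u₀ ht0,
      coeFn_duhamel_gradOp hdp ht0 (h.continuousOn.mono (Icc_subset_Icc_right ht.2)),
      Lp.coeFn_add (linearFlow u₀ t)
        (duhamel (gradOp d p) (fun s => mulL d p (U s) (U s)) t)] with x h1 h2 h3 h4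
    rw [h1, h4, Pi.add_apply, h2.2, h3.2]
  · rintro ⟨hc, he⟩
    have hc' : ∀ t ∈ Ioc 0 τ, ContinuousOn U (Icc 0 t) := fun t ht =>
      hc.mono (Icc_subset_Icc_right ht.2)
    refine ⟨hc, ?_, fun t ht => ?_, fun t ht => ?_, fun t ht => ?_, fun t ht => ?_⟩
    · rw [he 0 (left_mem_Icc.2 hτ.le), linearFlow_zero, duhamel, intervalIntegral.integral_same,
        add_zero]
    · filter_upwards [coeFn_linearFlow u₀ ht.1] with x hx using hx.1
    · refine Eventually.of_forall fun x ℓ => ?_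
      -- The single time `s = t`, where the kernel is evaluated at `0`, is discarded as a null set.
      filter_upwards [ae_restrict_mem measurableSet_Ioc,
        ae_restrict_of_ae (Measure.ae_ne volume t)] with s hs hst
      exact integrable_kernelDeriv_sq ℓ (sub_pos.2 (lt_of_le_of_ne hs.2 hst)) (U s) x
    · filter_upwards [coeFn_duhamel_gradOp hdp ht.1 (hc' t ht)] with x hx using hx.1
    · have h0 := Lp.coeFn_add (linearFlow u₀ t)
        (duhamel (gradOp d p) (fun s => mulL d p (U s) (U s)) t)
      rw [← he t ⟨ht.1.le, ht.2⟩] at h0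
      filter_upwards [h0, coeFn_linearFlow u₀ ht.1, coeFn_duhamel_gradOp hdp ht.1 (hc' t ht)]
        with x h1 h2 h3
      rw [h1, Pi.add_apply, h2.2, h3.2]

theorem IsMildSolution.eqOn (hdp : (d : ℝ) < 6 * p) {u₀ : L2p d p} {τ : ℝ} (hτ : 0 < τ)
    {U V : ℝ → L2p d p} (hU : IsMildSolution u₀ τ U) (hV : IsMildSolution u₀ τ V) :
    EqOn V U (Icc 0 τ) := by
  obtain ⟨C, hC, hB⟩ := exists_norm_gradOp_le (p := p) d τ
  rw [isMildSolution_iff hdp hτ] at hU hV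
  exact eqOn_of_quadratic_duhamel hτ.le hC (kernel_exponent_lt_one hdp) continuousOn_gradOp hB
    hU.1 hV.1 hU.2 hV.2

theorem exists_isMildSolution (hdp : (d : ℝ) < 6 * p) {T : ℝ} (hT : 0 < T) (u₀ : L2p d p) :
    ∃ τ ∈ Ioc 0 T, ∃ U : ℝ → L2p d p, IsMildSolution u₀ τ U := by
  obtain ⟨C, hC, hB⟩ := exists_norm_gradOp_le (p := p) d T
  obtain ⟨τ, hτ, U, hU⟩ := exists_quadratic_duhamel (b := mulL d p) hT hC
    (kernel_exponent_lt_one hdp) continuousOn_gradOp hB (continuousOn_linearFlow u₀ T)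
  exact ⟨τ, hτ, U, (isMildSolution_iff hdp hτ.1).2 hU⟩

end MildSolution

end KSB

end

theorem mainTheorem2 (d : ℕ) (hd : 1 ≤ d) (p : ℝ) [Fact (1 ≤ p)] (hdp : (d : ℝ) < 6 * p)
    (T : ℝ) (hT : 0 < T) (u₀ : KSB.L2p d p) :
    (∃ τ ∈ Set.Ioc 0 T, ∃ U : ℝ → KSB.L2p d p, KSB.IsMildSolution u₀ τ U ∧
      ∀ V : ℝ → KSB.L2p d p, KSB.IsMildSolution u₀ τ V → Set.EqOn V U (Set.Icc 0 τ)) ∧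
    (∀ U V : ℝ → KSB.L2p d p, KSB.IsMildSolution u₀ T U → KSB.IsMildSolution u₀ T V →
      Set.EqOn V U (Set.Icc 0 T)) := by
  refine ⟨?_, fun U V hU hV => hU.eqOn hdp hT hV⟩
  obtain ⟨τ, hτ, U, hU⟩ := KSB.exists_isMildSolution hdp hT u₀
  exact ⟨τ, hτ, U, hU, fun V hV => hU.eqOn hdp hτ.1 hV⟩
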